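/- Model. Let $\Omega$ be a (standard Borel) state space with prior $D\in\Delta(\Omega)$. An agent has a private type $\theta\in\Theta=[\underline\theta,\overline\theta]$ with $\underline\theta\ge 0$, drawn from a distribution $F$, and her value at the belief $\mu\in\Delta(\Omega)$ is separable, $V(\mu,\theta)=v(\mu)\,\theta$, and monotone in $\mu$ in the Blackwell order (so that $v$ is convex). An experiment is a map $\sigma:\Omega\to\Delta(S)$ for some signal space $S$; $\sigma|\mu$ is the distribution over posteriors that it induces at the belief $\mu$; $\sigma_{\rm no}$ is the null experiment. The agent has a set $\hat\Sigma\ni\sigma_{\rm no}$ of experiments, with costs $C(\sigma,\mu)\ge 0$ and $C(\sigma_{\rm no},\cdot)=0$, and we put $$V(\mu,\hat\Sigma,\theta)=\sup_{\sigma\in\hat\Sigma}\;\mathbf E_{\hat\mu\sim\sigma|\mu}[V(\hat\mu,\theta)]-C(\sigma,\mu).$$ A mechanism $(\pi,p)$ assigns to each type $\theta$ a distribution $\pi(\theta)$ over experiments, the realized experiment being announced to the agent, and a payment $p(\theta)\in\mathbf R$; $\mu\sim\pi(\theta)|D$ is the belief that results from the prior. It is incentive compatible if $\mathbf E_{\mu\sim\pi(\theta)|D}[V(\mu,\hat\Sigma,\theta)]-p(\theta)\ge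 \mathbf E_{\mu\sim\pi(\theta')|D}[V(\mu,\hat\Sigma,\theta)]-p(\theta')$ for all $\theta,\theta'$, and individually rational if $\mathbf E_{\mu\sim\pi(\theta)|D}[V(\mu,\hat\Sigma,\theta)]-p(\theta)\ge V(D,\hat\Sigma,\theta)$ for all $\theta$. It is optimal for $\hat\Sigma$ if it maximizes the revenue $\mathbf E_{\theta\sim F}[p(\theta)]$ among the incentive compatible and individually rational mechanisms. The expected value of type $\theta$ is $\mathbf E_{\mu\sim\pi(\theta)|D}[V(\mu,\hat\Sigma,\theta)]$; the social welfare is its expectation over $\theta\sim F$; the expected utility of the agent is the social welfare minus the revenue. All expectations involved are assumed to exist. Proposition. For any such $V$, $D$, $F$ and $C$, the social welfare, the expected utility of the agent and, for almost every type, the expected value of the type are minimized in the revenue-optimal mechanism when $|\hat\Sigma|=1$, i.e. $\hat\Sigma=\{\sigma_{\rm no}\}$. Precisely, write $M_0\preceq M$ if each of these three quantities is at most as large in the mechanism $M_0$ with $\{\sigma_{\rm no}\}$ as in the mechanism $M$ with $\hat\Sigma$. (1) There is an optimal mechanism $M_0$ for $\{\sigma_{\rm no}\}$ such that $M_0\preceq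 M$ for every $\hat\Sigma$ and every optimal mechanism $M$ for $\hat\Sigma$. (2) For every $\hat\Sigma$ for which an optimal mechanism exists, there is an optimal mechanism $M$ for $\hat\Sigma$ such that $M_0\preceq M$ for every optimal mechanism $M_0$ for $\{\sigma_{\rm no}\}$. (3) If the monopoly type is unique, i.e. $\theta\mapsto\theta\cdot\Pr_{z\sim F}[z\ge\theta]$ has exactly one maximizer in $\Theta$, then $M_0\preceq M$ for every $\hat\Sigma$, every optimal mechanism $M_0$ for $\{\sigma_{\rm no}\}$ and every optimal mechanism $M$ for $\hat\Sigma$. -/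

import Mathlib

open MeasureTheory ProbabilityTheory

universe u

noncomputable section

namespace SellingData

/-- A belief over the states: an element of `Δ(Ω)`. -/
abbrev Belief (Ω : Type u) [MeasurableSpace Ω] : Type u := ProbabilityMeasure Ω

/-- An experiment (information structure) `σ : Ω → Δ(S)` with an arbitrary signal space `S`. -/
structure Experiment (Ω : Type u) [MeasurableSpace Ω] where
  /-- the signal space -/
  Signal : Type u
  [measurableSpaceSignal : MeasurableSpace Signal]
  /-- the law of the signal in each state -/
  kernel : Kernel Ω Signal
  [isMarkovKernel : IsMarkovKernel kernel]

attribute [instance] Experiment.measurableSpaceSignal Experiment.isMarkovKernel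

namespace Experiment

variable {Ω : Type u} [MeasurableSpace Ω]

/-- The null experiment, whose signal is constant. -/
def null (Ω : Type u) [MeasurableSpace Ω] : Experiment Ω where
  Signal := PUnit
  kernel := Kernel.const Ω (Measure.dirac PUnit.unit)

/-- Blackwell order: `σ` is a garbling of `τ`. -/
def IsGarblingOf (σ τ : Experiment Ω) : Prop :=
  ∃ η : Kernel τ.Signal σ.Signal, IsMarkovKernel η ∧ σ.kernel = η ∘ₖ τ.kernel

variable [StandardBorelSpace Ω] [Nonempty Ω]

/-- The posterior belief after the signal `s` of the experiment `σ`, given the prior belief `μ`. -/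
def posteriorBelief (σ : Experiment Ω) (μ : Belief Ω) (s : σ.Signal) : Belief Ω :=
  ⟨posterior σ.kernel (μ : Measure Ω) s, inferInstance⟩

/-- `σ | μ`: the distribution over posterior beliefs induced by `σ` given the prior belief `μ`. -/
def posteriorLaw (σ : Experiment Ω) (μ : Belief Ω) : Measure (Belief Ω) :=
  (σ.kernel ∘ₘ (μ : Measure Ω)).map (σ.posteriorBelief μ)

end Experiment

/-- A distribution over experiments: an index is drawn from `law`, independently of the state,
and the experiment with this index is announced and run. -/
structure RandomExperiment (Ω : Type u) [MeasurableSpace Ω] where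
  /-- the indices of the experiments among which the lottery chooses -/
  Index : Type u
  [measurableSpaceIndex : MeasurableSpace Index]
  /-- the law of the index -/
  law : Measure Index
  [isProbabilityMeasure : IsProbabilityMeasure law]
  /-- the common signal space of these experiments -/
  Signal : Type u
  [measurableSpaceSignal : MeasurableSpace Signal]
  /-- the law of the signal, given the state and the index -/
  kernel : Kernel (Ω × Index) Signal
  [isMarkovKernel : IsMarkovKernel kernel]

attribute [instance] RandomExperiment.measurableSpaceIndex RandomExperiment.isProbabilityMeasure
  RandomExperiment.measurableSpaceSignal RandomExperiment.isMarkovKernel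

/-- What the agent observes: the realized experiment (its index) together with its signal. -/
def RandomExperiment.observed {Ω : Type u} [MeasurableSpace Ω] (π : RandomExperiment Ω) :
    Experiment Ω where
  Signal := π.Index × π.Signal
  kernel := Kernel.const Ω π.law ⊗ₖ π.kernel

/-- `V` is monotone in the Blackwell order at the belief `μ`: expected values exist, and they are
larger for more informative experiments. -/
def BlackwellMonotoneAt {Ω : Type u} [MeasurableSpace Ω] [StandardBorelSpace Ω] [Nonempty Ω]
    (V : Belief Ω → ℝ) (μ : Belief Ω) : Prop :=
  (∀ σ : Experiment Ω, Integrable V (σ.posteriorLaw μ)) ∧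
  ∀ σ τ : Experiment Ω, σ.IsGarblingOf τ →
    ∫ ν, V ν ∂(σ.posteriorLaw μ) ≤ ∫ ν, V ν ∂(τ.posteriorLaw μ)

/-- The primitives of the model, except for the set of experiments available to the agent. The
type space is the interval `[lo, hi]`. -/
structure Market (Ω : Type u) [MeasurableSpace Ω] where
  /-- the lowest type -/
  lo : ℝ
  /-- the highest type -/
  hi : ℝ
  /-- the prior over states -/
  prior : Belief Ω
  /-- the distribution of the type -/
  typeLaw : Measure (Set.Icc lo hi)
  /-- the valuation `V(μ, θ)` -/
  value : Belief Ω → Set.Icc lo hi → ℝ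
  /-- the agent's cost of an experiment, given her belief -/
  cost : Experiment Ω → Belief Ω → ℝ

/-- A revelation mechanism: an allocation `π : Θ → Δ(Σ)` and a payment rule `p : Θ → ℝ`. -/
structure Mechanism {Ω : Type u} [MeasurableSpace Ω] (E : Market Ω) where
  /-- the (random) experiment sold to each type -/
  alloc : Set.Icc E.lo E.hi → RandomExperiment Ω
  /-- the payment of each type -/
  pay : Set.Icc E.lo E.hi → ℝ

namespace Market

variable {Ω : Type u} [MeasurableSpace Ω]

/-- The valuation is separable: `V(μ, θ) = v(μ) θ`. -/
def IsSeparable (E : Market Ω) : Prop :=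
  ∃ v : Belief Ω → ℝ, ∀ μ θ, E.value μ θ = v μ * (θ : ℝ)

/-- The revenue `θ · Pr[z ≥ θ]` of the price `θ` for an item whose value is the type. -/
def priceRevenue (E : Market Ω) (θ : Set.Icc E.lo E.hi) : ℝ :=
  (θ : ℝ) * E.typeLaw.real (Set.Ici θ)

/-- `θ` is a monopoly type: it maximizes `θ · Pr[z ≥ θ]`. -/
def IsMonopolyType (E : Market Ω) (θ : Set.Icc E.lo E.hi) : Prop :=
  ∀ z, E.priceRevenue z ≤ E.priceRevenue θ

variable [StandardBorelSpace Ω] [Nonempty Ω]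

/-- Blackwell monotonicity of the valuation of every type, at (almost) all beliefs that can arise
from the prior. -/
def IsBlackwellMonotone (E : Market Ω) : Prop :=
  ∀ (θ : Set.Icc E.lo E.hi) (τ : Experiment Ω),
    ∀ᵐ μ ∂(τ.posteriorLaw E.prior), BlackwellMonotoneAt (fun ν => E.value ν θ) μ

/-- `V(μ, Σ', θ)`: the optimal utility of type `θ` with belief `μ` when she can conduct the
experiments in `Σ'`. -/
def indirectValue (E : Market Ω) (A : Set (Experiment Ω)) (μ : Belief Ω)
    (θ : Set.Icc E.lo E.hi) : ℝ :=
  ⨆ σ : A, ((∫ ν, E.value ν θ ∂((σ : Experiment Ω).posteriorLaw μ)) - E.cost σ μ)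

/-- A set of experiments that the agent may have: it contains the null experiment, costs are
nonnegative on it, and the expectations of the resulting optimal utilities exist. -/
structure IsAvailable (E : Market Ω) (A : Set (Experiment Ω)) : Prop where
  null_mem : Experiment.null Ω ∈ A
  cost_nonneg : ∀ σ ∈ A, ∀ μ, 0 ≤ E.cost σ μ
  integrable : ∀ (θ : Set.Icc E.lo E.hi) (τ : Experiment Ω),
    Integrable (fun μ => E.indirectValue A μ θ) (τ.posteriorLaw E.prior)

end Market

namespace Mechanism

variable {Ω : Type u} [MeasurableSpace Ω] [StandardBorelSpace Ω] [Nonempty Ω] {E : Market Ω}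

/-- The expected value of type `θ`, net of the cost of her own experiment, from the allocation of
the reported type `r`. -/
def grossUtility (M : Mechanism E) (A : Set (Experiment Ω)) (r θ : Set.Icc E.lo E.hi) : ℝ :=
  ∫ μ, E.indirectValue A μ θ ∂((M.alloc r).observed.posteriorLaw E.prior)

/-- Incentive compatibility. -/
def IsIC (M : Mechanism E) (A : Set (Experiment Ω)) : Prop :=
  ∀ θ r, M.grossUtility A r θ - M.pay r ≤ M.grossUtility A θ θ - M.pay θ

/-- Individual rationality. -/
def IsIR (M : Mechanism E) (A : Set (Experiment Ω)) : Prop :=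
  ∀ θ, E.indirectValue A E.prior θ ≤ M.grossUtility A θ θ - M.pay θ

/-- Incentive compatible and individually rational, with a well-defined expected revenue. -/
def IsFeasible (M : Mechanism E) (A : Set (Experiment Ω)) : Prop :=
  M.IsIC A ∧ M.IsIR A ∧ Integrable M.pay E.typeLaw

/-- The expected revenue of the data broker. -/
def revenue (M : Mechanism E) : ℝ := ∫ θ, M.pay θ ∂E.typeLaw

/-- `M` is a revenue-optimal mechanism when the agent can conduct the experiments in `A`. -/
def IsOptimal (M : Mechanism E) (A : Set (Experiment Ω)) : Prop :=
  M.IsFeasible A ∧ ∀ M' : Mechanism E, M'.IsFeasible A → M'.revenue ≤ M.revenue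

/-- The social welfare: the expected value of the agent, net of the costs of her experiments
(payments are transfers and cancel). -/
def welfare (M : Mechanism E) (A : Set (Experiment Ω)) : ℝ :=
  ∫ θ, M.grossUtility A θ θ ∂E.typeLaw

/-- The expected utility of the agent. -/
def agentUtility (M : Mechanism E) (A : Set (Experiment Ω)) : ℝ :=
  ∫ θ, (M.grossUtility A θ θ - M.pay θ) ∂E.typeLaw

/-- Mechanism `M₀` (with experiments `A₀`) yields at most the social welfare, at most the expected
utility of the agent, and for almost every type at most the expected value, that `M` (with
experiments `A`) yields. -/
def OutcomeLE (M₀ : Mechanism E) (A₀ : Set (Experiment Ω)) (M : Mechanism E)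
    (A : Set (Experiment Ω)) : Prop :=
  M₀.welfare A₀ ≤ M.welfare A ∧
  M₀.agentUtility A₀ ≤ M.agentUtility A ∧
  ∀ᵐ θ ∂E.typeLaw, M₀.grossUtility A₀ θ θ ≤ M.grossUtility A θ θ

end Mechanism

end SellingData

end

/-! Let v₀ be the value of the prior and v₁ that of full information at the prior, Δ = v₁ - v₀, and
let w(θ) be the utility of the truthful type θ minus v₀θ. Incentive compatibility makes w convex
with slopes in [0, Δ]; let D be its right derivative. Because costs are nonnegative, the gross value
of a fixed allocation, divided by the type, is nondecreasing in the type. Hence the gross value of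
type θ exceeds v₀θ by at most θD(θ), and the payment is at most θD(θ) - w(θ), whatever experiments
the agent owns (`exists_isEnvelope`). This is the envelope bound for selling a single item, with D
in the role of the allocation.

Cutting D into its superlevel sets turns this bound into a mixture of posted prices over the levels
t in (0, Δ). So the payments of the types above a, plus w(a)·Pr[z ≥ a], are at most Δ times the
monopoly revenue (`setIntegral_pay_le`). Equality forces almost every layer to be a monopoly price,
so that D = Δ strictly above the greatest monopoly type (`top_of_attains`) and, if the equality
concerns all types, D = 0 below the least one (`bot_of_attains`).

The bound above a monopoly type can always be reached: sell full information to all types above it,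
at the price that leaves this type indifferent (`sellFullAbove`). Optimal mechanisms therefore
inform almost every type above the greatest monopoly type fully, for any set of experiments. Without
acquisition a posted price reaches the bound over all types, so optimal mechanisms leave the types
below the least monopoly type with the value of the prior. The comparison follows since v₀θ and v₁θ
bound every expected value and v₀θ bounds every participating utility from below. A gap between the
least and the greatest monopoly type is what restricts parts (1) and (2) to a chosen mechanism. -/

namespace SellingData

/-! ### Right derivatives of convex functions -/

section RightSlope

/-- A convex function on `[lo, hi]` whose slopes lie in `[0, Δ]` has a monotone selection of
right derivatives, with the value `Δ` at the right end. -/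
theorem exists_rightSlope {w : ℝ → ℝ} {lo hi Δ : ℝ} (hw : ConvexOn ℝ (Set.Icc lo hi) w)
    (hlohi : lo ≤ hi) (hΔ : 0 ≤ Δ)
    (h0 : ∀ z y, lo ≤ z → z ≤ y → y ≤ hi → w z ≤ w y)
    (h1 : ∀ z y, lo ≤ z → z ≤ y → y ≤ hi → w y ≤ w z + Δ * (y - z)) :
    ∃ D : ℝ → ℝ, Monotone D ∧ (∀ z, 0 ≤ D z) ∧ (∀ z, D z ≤ Δ) ∧ D hi = Δ ∧
      (∀ z y, lo ≤ z → z ≤ y → y ≤ hi → w z + D z * (y - z) ≤ w y) ∧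
      (∀ z y, lo ≤ z → z < y → y < hi → w y ≤ w z + D y * (y - z)) ∧
      (∀ z s, lo ≤ z → z < hi → (∀ y, z < y → y ≤ hi → s * (y - z) ≤ w y - w z) → s ≤ D z) := by
  classical
  set S : ℝ → Set ℝ := fun z => (fun y => (w y - w z) / (y - z)) '' Set.Ioc z hi with hS
  have hne : ∀ z, z < hi → (S z).Nonempty := fun z hz => ⟨_, hi, ⟨hz, le_rfl⟩, rfl⟩
  have hpos : ∀ z, lo ≤ z → ∀ s ∈ S z, 0 ≤ s := by
    rintro z hz s ⟨y, hy, rfl⟩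
    exact div_nonneg (sub_nonneg.2 (h0 z y hz hy.1.le hy.2)) (sub_nonneg.2 hy.1.le)
  have hbdd : ∀ z, lo ≤ z → BddBelow (S z) := fun z hz => ⟨0, fun s hs => hpos z hz s hs⟩
  have hle : ∀ z, lo ≤ z → z < hi → sInf (S z) ≤ Δ := by
    intro z hz hzh
    refine (csInf_le (hbdd z hz) ⟨hi, ⟨hzh, le_rfl⟩, rfl⟩).trans ?_
    have := h1 z hi hz hzh.le le_rfl
    rw [div_le_iff₀ (sub_pos.2 hzh)]
    linarith
  have hleft : ∀ z y, lo ≤ z → z < y → y < hi → (w y - w z) / (y - z) ≤ sInf (S y) := by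
    intro z y hz hzy hy
    refine le_csInf (hne y hy) ?_
    rintro s ⟨x, hx, rfl⟩
    exact hw.slope_mono_adjacent ⟨hz, (hzy.trans hy).le⟩ ⟨hz.trans (hzy.trans hx.1).le, hx.2⟩
      hzy hx.1
  -- The infimum of the slopes to the right is the right derivative. There is no such slope at `hi`;
  -- the value `Δ` there keeps monotonicity and is large enough to dominate the allocation of the
  -- highest type. The value 0 below `lo` makes the function monotone on the whole line.
  refine ⟨fun z => if z < lo then 0 else if z < hi then sInf (S z) else Δ, ?_, ?_, ?_, ?_, ?_, ?_,
    ?_⟩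
  · intro z y hzy
    dsimp only
    split_ifs with a1 a2 a3 a4 a5 a6 a7
    · exact le_rfl
    · exact le_csInf (hne y a3) (hpos y (not_lt.1 a2))
    · exact hΔ
    · linarith
    · rcases hzy.eq_or_lt with rfl | hlt
      · exact le_rfl
      · exact (csInf_le (hbdd z (not_lt.1 a1)) ⟨y, ⟨hlt, a6.le⟩, rfl⟩).trans
          (hleft z y (not_lt.1 a1) hlt a6)
    · exact hle z (not_lt.1 a1) a4
    all_goals first | exact le_rfl | linarith
  · intro z
    dsimp only
    split_ifs with a1 a2
    · exact le_rfl
    · exact le_csInf (hne z a2) (hpos z (not_lt.1 a1))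
    · exact hΔ
  · intro z
    dsimp only
    split_ifs with a1 a2
    · exact hΔ
    · exact hle z (not_lt.1 a1) a2
    · exact le_rfl
  · dsimp only
    split_ifs with a1 a2
    · exact absurd a1 (not_lt.2 hlohi)
    · exact absurd a2 (lt_irrefl _)
    · rfl
  · intro z y hz hzy hy
    rcases hzy.eq_or_lt with rfl | hlt
    · simp
    dsimp only
    rw [if_neg (not_lt.2 hz), if_pos (hlt.trans_le hy)]
    have := csInf_le (hbdd z hz) ⟨y, ⟨hlt, hy⟩, rfl⟩
    rw [le_div_iff₀ (sub_pos.2 hlt)] at this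
    linarith
  · intro z y hz hlt hy
    dsimp only
    rw [if_neg (not_lt.2 (hz.trans hlt.le)), if_pos hy]
    have := hleft z y hz hlt hy
    rw [div_le_iff₀ (sub_pos.2 hlt)] at this
    linarith
  · intro z s hz hzh hs
    dsimp only
    rw [if_neg (not_lt.2 hz), if_pos hzh]
    refine le_csInf (hne z hzh) ?_
    rintro _ ⟨y, hy, rfl⟩
    rw [le_div_iff₀ (sub_pos.2 hy.1)]
    exact hs y hy.1 hy.2

/-- A monotone function that supports `w` from the right integrates to at most the increment
of `w`. -/
theorem integral_le_of_right_support {w D : ℝ → ℝ} {a b : ℝ} (hab : a ≤ b) (hD : Monotone D)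
    (h : ∀ z y, a ≤ z → z ≤ y → y ≤ b → w z + D z * (y - z) ≤ w y) :
    ∫ z in a..b, D z ≤ w b - w a := by
  have key : ∀ n : ℕ, ∫ z in a..b, D z ≤ w b - w a + (D b - D a) * (b - a) * (1 / ((n : ℝ) + 1)) := by
    intro n
    set d : ℝ := (b - a) / (n + 1) with hd
    have hn : (0 : ℝ) < n + 1 := by positivity
    have hd0 : 0 ≤ d := div_nonneg (sub_nonneg.2 hab) hn.le
    have hdn : (n + 1) * d = b - a := by rw [hd]; field_simp
    -- On each cell the integral is at most the right-endpoint value times `d`, while the support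
    -- inequality controls the left-endpoint value. The differences of the two telescope.
    have step : ∀ k : ℕ, k ≤ n + 1 → ∫ z in a..(a + k * d), D z ≤
        w (a + k * d) - w a + (D (a + k * d) - D a) * d := by
      intro k
      induction k with
      | zero => intro _; simp
      | succ k ih =>
        intro hk
        have ih := ih (by omega)
        have hkn : ((k : ℝ) + 1) * d ≤ b - a := by
          rw [← hdn]
          gcongr
          exact_mod_cast (by omega : k ≤ n)
        have hkd : 0 ≤ (k : ℝ) * d := by positivity
        have hle : a + (k : ℝ) * d ≤ a + ((k + 1 : ℕ) : ℝ) * d := by push_cast; linarith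
        rw [← intervalIntegral.integral_add_adjacent_intervals (b := a + k * d)
          hD.intervalIntegrable hD.intervalIntegrable]
        have h2 : ∫ z in (a + k * d)..(a + ((k + 1 : ℕ) : ℝ) * d), D z ≤
            D (a + ((k + 1 : ℕ) : ℝ) * d) * d := by
          have := intervalIntegral.integral_mono_on (μ := volume) hle hD.intervalIntegrable
            (intervalIntegrable_const (c := D (a + ((k + 1 : ℕ) : ℝ) * d))) (fun x hx => hD hx.2)
          refine this.trans (le_of_eq ?_)
          rw [intervalIntegral.integral_const, smul_eq_mul]
          push_cast; ring
        have h3 := h (a + k * d) (a + ((k + 1 : ℕ) : ℝ) * d) (by linarith) hle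
          (by push_cast; linarith)
        have h4 : a + ((k + 1 : ℕ) : ℝ) * d - (a + k * d) = d := by push_cast; ring
        rw [h4] at h3
        nlinarith
    have := step (n + 1) le_rfl
    have e : a + ((n + 1 : ℕ) : ℝ) * d = b := by push_cast; linarith
    rw [e] at this
    refine this.trans (le_of_eq ?_)
    rw [hd]; ring
  have lim : Filter.Tendsto (fun n : ℕ => w b - w a + (D b - D a) * (b - a) * (1 / ((n : ℝ) + 1)))
      Filter.atTop (nhds (w b - w a + (D b - D a) * (b - a) * 0)) :=
    (tendsto_one_div_add_atTop_nhds_zero_nat.const_mul _).const_add _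
  simpa using ge_of_tendsto' lim key

end RightSlope

/-! ### Layer-cake decomposition into posted prices -/

section Layers

/-- The first point of `[a, b]` at which `D` exceeds the level `t` (and `b` if there is none). -/
noncomputable def firstAbove (D : ℝ → ℝ) (a b t : ℝ) : ℝ :=
  sInf {z | a ≤ z ∧ (t < D z ∨ b ≤ z)}

variable {D : ℝ → ℝ} {a b t : ℝ}

theorem bddBelow_above (D : ℝ → ℝ) (a b t : ℝ) : BddBelow {z | a ≤ z ∧ (t < D z ∨ b ≤ z)} :=
  ⟨a, fun _ hz => hz.1⟩

theorem firstAbove_le_right (hab : a ≤ b) : firstAbove D a b t ≤ b :=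
  csInf_le (bddBelow_above D a b t) ⟨hab, Or.inr le_rfl⟩

theorem le_firstAbove (hab : a ≤ b) : a ≤ firstAbove D a b t :=
  le_csInf ⟨b, hab, Or.inr le_rfl⟩ fun _ hz => hz.1

theorem firstAbove_le {z : ℝ} (hz : a ≤ z) (h : t < D z) : firstAbove D a b t ≤ z :=
  csInf_le (bddBelow_above D a b t) ⟨hz, Or.inl h⟩

theorem le_firstAbove_of_le (hD : Monotone D) (hab : a ≤ b) {z : ℝ} (hzb : z ≤ b) (h : D z ≤ t) :
    z ≤ firstAbove D a b t := by
  refine le_csInf ⟨b, hab, Or.inr le_rfl⟩ ?_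
  rintro y ⟨_, hy | hy⟩
  · by_contra hlt
    exact absurd (hD (not_le.1 hlt).le) (not_le.2 (h.trans_lt hy))
  · exact hzb.trans hy

theorem lt_of_firstAbove_lt (hD : Monotone D) (hab : a ≤ b) {z : ℝ}
    (h : firstAbove D a b t < z) (hzb : z ≤ b) : t < D z := by
  by_contra hn
  exact absurd (le_firstAbove_of_le (a := a) hD hab hzb (not_lt.1 hn)) (not_le.2 h)

theorem monotone_firstAbove (D : ℝ → ℝ) (hab : a ≤ b) : Monotone (firstAbove D a b) := by
  intro s t hst
  refine csInf_le_csInf (bddBelow_above D a b s) ⟨b, hab, Or.inr le_rfl⟩ ?_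
  rintro z ⟨hz, h | h⟩
  · exact ⟨hz, Or.inl (hst.trans_lt h)⟩
  · exact ⟨hz, Or.inr h⟩

/-- Layer-cake bound for the envelope payment of the allocation `D`. -/
theorem mul_sub_integral_le_layers (hD : Monotone D) (hD0 : ∀ z, 0 ≤ D z) (hab : a ≤ b)
    {θ : ℝ} (hθ : θ ∈ Set.Icc a b) :
    θ * D θ - ∫ z in a..θ, D z ≤ ∫ t in Set.Ioo 0 (D θ), firstAbove D a b t := by
  have hint : IntegrableOn D (Set.Ioc a θ) :=
    (hD.intervalIntegrable (μ := volume) (a := a) (b := θ)).1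
  have hc : IntegrableOn (firstAbove D a b) (Set.Ioo 0 (D θ)) :=
    ((monotone_firstAbove D hab).intervalIntegrable (μ := volume) (a := 0) (b := D θ)).1.mono_set
      Set.Ioo_subset_Ioc_self
  have hsub : ∫ t in Set.Ioo 0 (D θ), (θ - firstAbove D a b t) ≤ ∫ z in a..θ, D z := by
    rw [intervalIntegral.integral_of_le hθ.1,
      hint.integral_eq_integral_meas_lt (Filter.Eventually.of_forall hD0)]
    -- The superlevel set at `t` contains everything in `(a, θ]` beyond its first point.
    have hm : ∀ t, t < D θ → θ - firstAbove D a b t ≤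
        (volume.restrict (Set.Ioc a θ)).real {z | t < D z} := by
      intro t ht
      have hs : Set.Ioc (firstAbove D a b t) θ ⊆ {z | t < D z} ∩ Set.Ioc a θ := fun z hz =>
        ⟨lt_of_firstAbove_lt hD hab hz.1 (hz.2.trans hθ.2),
          (le_firstAbove hab).trans_lt hz.1, hz.2⟩
      have hme : MeasurableSet {z | t < D z} := measurableSet_lt measurable_const hD.measurable
      rw [measureReal_restrict_apply hme]
      calc θ - firstAbove D a b t = volume.real (Set.Ioc (firstAbove D a b t) θ) := by
            rw [Real.volume_real_Ioc_of_le (firstAbove_le hθ.1 ht)]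
        _ ≤ _ := measureReal_mono hs (ne_of_lt ((measure_mono Set.inter_subset_right).trans_lt
            (by simp)))
    have hanti : Antitone fun t => (volume.restrict (Set.Ioc a θ)).real {z | t < D z} :=
      fun s t hst => measureReal_mono fun z hz => lt_of_le_of_lt hst hz
    -- Bounded and monotone up to the level `D θ`, and zero beyond it, because `D` does not exceed
    -- `D θ` on `(a, θ]`.
    have hInt : IntegrableOn (fun t => (volume.restrict (Set.Ioc a θ)).real {z | t < D z})
        (Set.Ioi 0) := by
      have hz : ∀ t ∈ Set.Ioi (D θ), (volume.restrict (Set.Ioc a θ)).real {z | t < D z} = 0 := by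
        intro t ht
        have hme : MeasurableSet {z | t < D z} := measurableSet_lt measurable_const hD.measurable
        rw [measureReal_restrict_apply hme]
        convert measureReal_empty
        ext z
        simp only [Set.mem_inter_iff, Set.mem_ofPred_eq, Set.mem_empty_iff_false, iff_false]
        rintro ⟨hz, hz'⟩
        exact absurd (hD hz'.2) (not_le.2 ((Set.mem_Ioi.1 ht).trans hz))
      rw [← Set.Ioc_union_Ioi_eq_Ioi (hD0 θ)]
      refine IntegrableOn.union ?_ ?_
      · exact (hanti.intervalIntegrable (μ := volume) (a := 0) (b := D θ)).1
      · exact integrableOn_zero.congr_fun (fun t ht => (hz t ht).symm) measurableSet_Ioi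
    calc ∫ t in Set.Ioo 0 (D θ), (θ - firstAbove D a b t)
        ≤ ∫ t in Set.Ioo 0 (D θ), (volume.restrict (Set.Ioc a θ)).real {z | t < D z} := by
          refine setIntegral_mono_on ?_ (hInt.mono_set Set.Ioo_subset_Ioi_self) measurableSet_Ioo
            fun t ht => hm t ht.2
          exact (integrableOn_const (by simp)).sub hc
      _ ≤ _ := setIntegral_mono_set hInt (Filter.Eventually.of_forall fun t => measureReal_nonneg)
          (Filter.Eventually.of_forall Set.Ioo_subset_Ioi_self)
  have hci : Integrable (fun _ : ℝ => θ) (volume.restrict (Set.Ioo 0 (D θ))) :=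
    integrableOn_const (by simp)
  rw [integral_sub hci hc] at hsub
  have : ∫ _ in Set.Ioo 0 (D θ), θ = θ * D θ := by
    simp [hD0 θ, mul_comm]
  linarith

variable {T : Type*} [MeasurableSpace T] {ν : Measure T} [IsFiniteMeasure ν] {f : T → ℝ}
  {w : ℝ → ℝ} {Δ r : ℝ}

/-- The integral of the envelope payments is a mixture of the revenues of posted prices. -/
theorem integral_envelope_le_layers (hD : Monotone D) (hD0 : ∀ z, 0 ≤ D z) (hDΔ : ∀ z, D z ≤ Δ)
    (ha : 0 ≤ a) (hab : a ≤ b) (hf : Measurable f) (hfab : ∀ᵐ x ∂ν, f x ∈ Set.Icc a b)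
    (hw : ∀ z y, a ≤ z → z ≤ y → y ≤ b → w z + D z * (y - z) ≤ w y)
    (hint : Integrable (fun x => f x * D (f x) - (w (f x) - w a)) ν) :
    ∫ x, f x * D (f x) - (w (f x) - w a) ∂ν ≤
      ∫ t in Set.Ioo 0 Δ, firstAbove D a b t * ν.real {x | t < D (f x)} := by
  set g : T → ℝ → ℝ := fun x t => {p : T × ℝ | p.2 < D (f p.1)}.indicator
    (fun p => firstAbove D a b p.2) (x, t) with hg
  have hset : MeasurableSet {p : T × ℝ | p.2 < D (f p.1)} :=
    measurableSet_lt measurable_snd (hD.measurable.comp (hf.comp measurable_fst))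
  have hgm : Measurable (Function.uncurry g) :=
    (((monotone_firstAbove D hab).measurable).comp measurable_snd).indicator hset
  have hgi : Integrable (Function.uncurry g) (ν.prod (volume.restrict (Set.Ioo 0 Δ))) := by
    refine Integrable.of_bound hgm.aestronglyMeasurable b (Filter.Eventually.of_forall ?_)
    rintro ⟨x, t⟩
    simp only [Function.uncurry, hg, Set.indicator_apply]
    split_ifs
    · rw [Real.norm_of_nonneg (ha.trans (le_firstAbove hab))]
      exact firstAbove_le_right hab
    · simpa using ha.trans hab
  calc ∫ x, f x * D (f x) - (w (f x) - w a) ∂ν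
      ≤ ∫ x, (∫ t in Set.Ioo 0 Δ, g x t) ∂ν := by
        refine integral_mono_ae hint hgi.integral_prod_left ?_
        filter_upwards [hfab] with x hx
        have h1 := mul_sub_integral_le_layers hD hD0 hab hx
        have h2 := integral_le_of_right_support (w := w) hx.1 hD
          (fun z y hz hzy hy => hw z y hz hzy (hy.trans hx.2))
        have h3 : ∫ t in Set.Ioo 0 Δ, g x t = ∫ t in Set.Ioo 0 (D (f x)), firstAbove D a b t := by
          have : (fun t => g x t) = (Set.Iio (D (f x))).indicator (firstAbove D a b) := by
            ext t; simp [hg, Set.indicator_apply]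
          rw [this, setIntegral_indicator measurableSet_Iio]
          congr 2
          ext t
          simp only [Set.mem_inter_iff, Set.mem_Ioo, Set.mem_Iio]
          exact ⟨fun h => ⟨h.1.1, h.2⟩, fun h => ⟨⟨h.1, h.2.trans_le (hDΔ _)⟩, h.2⟩⟩
        rw [h3]
        linarith
    _ = ∫ t in Set.Ioo 0 Δ, ∫ x, g x t ∂ν := integral_integral_swap hgi
    _ = _ := by
        congr 1
        ext t
        have : (fun x => g x t) = {x | t < D (f x)}.indicator (fun _ => firstAbove D a b t) := by
          ext x; simp [hg, Set.indicator_apply]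
        have hm : MeasurableSet {x | t < D (f x)} :=
          measurableSet_lt measurable_const (hD.measurable.comp hf)
        rw [this, integral_indicator_const _ hm, smul_eq_mul, mul_comm]

/-- A superlevel set of `D` may or may not contain its first point; closing it only adds buyers, so
a layer earns no more than the posted price at that point. -/
theorem firstAbove_mul_le (hab : a ≤ b) (ha : 0 ≤ a) (hfab : ∀ᵐ x ∂ν, f x ∈ Set.Icc a b) :
    firstAbove D a b t * ν.real {x | t < D (f x)} ≤
      firstAbove D a b t * ν.real {x | firstAbove D a b t ≤ f x} := by
  refine mul_le_mul_of_nonneg_left ?_ (ha.trans (le_firstAbove hab))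
  refine ENNReal.toReal_mono (measure_ne_top _ _) (measure_mono_ae ?_)
  filter_upwards [hfab] with x hx h
  exact firstAbove_le hx.1 h

theorem integrableOn_layers (hab : a ≤ b) (ha : 0 ≤ a) :
    IntegrableOn (fun t => firstAbove D a b t * ν.real {x | t < D (f x)}) (Set.Ioo 0 Δ) := by
  have hanti : Antitone fun t => ν.real {x | t < D (f x)} :=
    fun s t hst => measureReal_mono fun z hz => lt_of_le_of_lt hst hz
  refine Integrable.of_bound ((monotone_firstAbove D hab).measurable.mul
    hanti.measurable).aestronglyMeasurable (b * ν.real Set.univ) (Filter.Eventually.of_forall ?_)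
  intro t
  have h0 : 0 ≤ firstAbove D a b t := ha.trans (le_firstAbove hab)
  rw [Real.norm_of_nonneg (mul_nonneg h0 measureReal_nonneg)]
  exact mul_le_mul (firstAbove_le_right hab) (measureReal_mono (Set.subset_univ _))
    measureReal_nonneg (ha.trans hab)

/-- Each of the layers, of total length `Δ`, earns at most the best posted-price revenue. -/
theorem integral_envelope_le (hΔ : 0 ≤ Δ) (hD : Monotone D) (hD0 : ∀ z, 0 ≤ D z)
    (hDΔ : ∀ z, D z ≤ Δ)
    (ha : 0 ≤ a) (hab : a ≤ b) (hf : Measurable f) (hfab : ∀ᵐ x ∂ν, f x ∈ Set.Icc a b)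
    (hw : ∀ z y, a ≤ z → z ≤ y → y ≤ b → w z + D z * (y - z) ≤ w y)
    (hint : Integrable (fun x => f x * D (f x) - (w (f x) - w a)) ν)
    (hr : ∀ z ∈ Set.Icc a b, z * ν.real {x | z ≤ f x} ≤ r) :
    ∫ x, f x * D (f x) - (w (f x) - w a) ∂ν ≤ Δ * r := by
  refine (integral_envelope_le_layers hD hD0 hDΔ ha hab hf hfab hw hint).trans ?_
  calc ∫ t in Set.Ioo 0 Δ, firstAbove D a b t * ν.real {x | t < D (f x)}
      ≤ ∫ t in Set.Ioo 0 Δ, r := by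
        refine setIntegral_mono (integrableOn_layers hab ha) (integrableOn_const (by simp)) ?_
        intro t
        exact (firstAbove_mul_le hab ha hfab).trans
          (hr _ ⟨le_firstAbove hab, firstAbove_le_right hab⟩)
    _ = Δ * r := by simp [hΔ]

/-- If the envelope payments attain the bound, then almost every layer attains it. -/
theorem ae_layer_eq (hΔ : 0 ≤ Δ) (hD : Monotone D) (hD0 : ∀ z, 0 ≤ D z) (hDΔ : ∀ z, D z ≤ Δ)
    (ha : 0 ≤ a) (hab : a ≤ b) (hf : Measurable f) (hfab : ∀ᵐ x ∂ν, f x ∈ Set.Icc a b)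
    (hw : ∀ z y, a ≤ z → z ≤ y → y ≤ b → w z + D z * (y - z) ≤ w y)
    (hint : Integrable (fun x => f x * D (f x) - (w (f x) - w a)) ν)
    (hr : ∀ z ∈ Set.Icc a b, z * ν.real {x | z ≤ f x} ≤ r)
    (heq : Δ * r ≤ ∫ x, f x * D (f x) - (w (f x) - w a) ∂ν) :
    ∀ᵐ t ∂(volume.restrict (Set.Ioo 0 Δ)),
      firstAbove D a b t * ν.real {x | t < D (f x)} = r := by
  have h1 := heq.trans (integral_envelope_le_layers hD hD0 hDΔ ha hab hf hfab hw hint)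
  have hi := integrableOn_layers (ν := ν) (D := D) (f := f) (Δ := Δ) hab ha
  have hle : (fun t => firstAbove D a b t * ν.real {x | t < D (f x)}) ≤ fun _ => r := fun t =>
    (firstAbove_mul_le hab ha hfab).trans (hr _ ⟨le_firstAbove hab, firstAbove_le_right hab⟩)
  have hc : Integrable (fun _ => r) (volume.restrict (Set.Ioo 0 Δ)) := integrableOn_const (by simp)
  refine (integral_eq_iff_of_ae_le hi hc (Filter.Eventually.of_forall hle)).1 ?_
  refine le_antisymm (integral_mono hi hc hle) ?_
  refine le_trans (le_of_eq ?_) h1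
  simp [hΔ]

/-- Turns failure of optimality on an interval of levels into its emptiness, since an interval of
positive length is not null. -/
theorem eq_of_ae_Ioo {P : ℝ → Prop} {s s' : ℝ} (h0 : 0 ≤ s) (hs : s ≤ s') (h1 : s' ≤ Δ)
    (h : ∀ᵐ t ∂(volume.restrict (Set.Ioo 0 Δ)), P t) (hP : ∀ t, s < t → t < s' → ¬ P t) :
    s = s' := by
  by_contra hne
  have hlt : s < s' := lt_of_le_of_ne hs hne
  have hsub : Set.Ioo s s' ⊆ Set.Ioo 0 Δ := Set.Ioo_subset_Ioo h0 h1
  have h2 := ae_restrict_of_ae_restrict_of_subset hsub h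
  have h3 : ∀ᵐ t ∂(volume.restrict (Set.Ioo s s')), False := by
    filter_upwards [h2, ae_restrict_mem measurableSet_Ioo] with t ht hm
    exact hP t hm.1 hm.2 ht
  rw [Filter.eventually_false_iff_eq_bot, ae_eq_bot, Measure.restrict_eq_zero] at h3
  simp at h3
  linarith

/-- Below all revenue-maximizing prices the allocation vanishes. -/
theorem eq_zero_of_ae_layer (hD0 : ∀ z, 0 ≤ D z) (hDΔ : ∀ z, D z ≤ Δ)
    (ha : 0 ≤ a) (hab : a ≤ b) (hfab : ∀ᵐ x ∂ν, f x ∈ Set.Icc a b)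
    (hae : ∀ᵐ t ∂(volume.restrict (Set.Ioo 0 Δ)),
      firstAbove D a b t * ν.real {x | t < D (f x)} = r)
    {θ : ℝ} (hθ : a ≤ θ) (h : ∀ z ∈ Set.Icc a θ, z * ν.real {x | z ≤ f x} < r) : D θ = 0 := by
  refine (eq_of_ae_Ioo le_rfl (hD0 θ) (hDΔ θ) hae ?_).symm
  intro t _ ht heq
  have := h _ ⟨le_firstAbove hab, firstAbove_le (b := b) hθ ht⟩
  linarith [firstAbove_mul_le (ν := ν) (D := D) (t := t) hab ha hfab]

/-- Above all revenue-maximizing prices the allocation is maximal. -/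
theorem eq_top_of_ae_layer (hD : Monotone D) (hD0 : ∀ z, 0 ≤ D z) (hDΔ : ∀ z, D z ≤ Δ)
    (ha : 0 ≤ a) (hab : a ≤ b) (hfab : ∀ᵐ x ∂ν, f x ∈ Set.Icc a b)
    (hae : ∀ᵐ t ∂(volume.restrict (Set.Ioo 0 Δ)),
      firstAbove D a b t * ν.real {x | t < D (f x)} = r)
    {θ : ℝ} (hθ : θ ∈ Set.Icc a b) (h0 : θ * ν.real {x | θ < f x} < r)
    (h : ∀ z ∈ Set.Ioc θ b, z * ν.real {x | z ≤ f x} < r) : D θ = Δ := by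
  refine eq_of_ae_Ioo (hD0 θ) (hDΔ θ) le_rfl hae ?_
  intro t ht _ heq
  have hle := le_firstAbove_of_le (a := a) hD hab hθ.2 ht.le
  -- If the layer starts exactly at `θ`, it excludes `θ` itself because `D θ` is below the level.
  -- Only the strict tail buys, hence the separate hypothesis `h0`.
  rcases hle.eq_or_lt with he | hlt
  · rw [← he] at heq
    have : ν.real {x | t < D (f x)} ≤ ν.real {x | θ < f x} := by
      refine measureReal_mono fun x hx => ?_
      by_contra hn
      exact absurd (hD (not_lt.1 hn)) (not_le.2 (ht.trans hx))
    have := mul_le_mul_of_nonneg_left this (ha.trans hθ.1)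
    linarith
  · have := h _ ⟨hlt, firstAbove_le_right hab⟩
    linarith [firstAbove_mul_le (ν := ν) (D := D) (t := t) hab ha hfab]

end Layers

end SellingData

/-! ### Posterior beliefs of the null and of the fully revealing experiment -/

namespace SellingData

/-- Any set containing `a` has mass at least one, measurable or not; neither `P` nor the singleton
has to be measurable. -/
theorem of_ae_dirac {α : Type*} [MeasurableSpace α] {P : α → Prop} {a : α}
    (h : ∀ᵐ x ∂(Measure.dirac a), P x) : P a := by
  by_contra hn
  have h1 : Measure.dirac a {x | ¬ P x} = 0 := h
  have h2 := Measure.le_dirac_apply (a := a) (s := {x | ¬ P x})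
  rw [h1, Set.indicator_of_mem (by exact hn)] at h2
  simp at h2

theorem integral_dirac_of_integrable {α : Type*} [MeasurableSpace α] {f : α → ℝ} {a : α}
    (h : Integrable f (Measure.dirac a)) : ∫ x, f x ∂(Measure.dirac a) = f a := by
  rw [integral_congr_ae h.1.ae_eq_mk, integral_dirac' _ _ h.1.stronglyMeasurable_mk]
  exact (of_ae_dirac h.1.ae_eq_mk).symm

/-- The belief that is certain of the state `ω`. -/
noncomputable def pointBelief {Ω : Type u} [MeasurableSpace Ω] (ω : Ω) : Belief Ω :=
  ⟨Measure.dirac ω, inferInstance⟩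

theorem measurable_pointBelief {Ω : Type u} [MeasurableSpace Ω] :
    Measurable (pointBelief : Ω → Belief Ω) :=
  Measure.measurable_dirac.subtype_mk

namespace Experiment

/-- The fully revealing experiment. -/
noncomputable def full (Ω : Type u) [MeasurableSpace Ω] : Experiment Ω where
  Signal := Ω
  kernel := Kernel.id

section

variable {Ω : Type u} [MeasurableSpace Ω]

theorem isGarblingOf_full (σ : Experiment Ω) : σ.IsGarblingOf (full Ω) :=
  ⟨σ.kernel, σ.isMarkovKernel, (Kernel.comp_id σ.kernel).symm⟩

theorem null_isGarblingOf (σ : Experiment Ω) : (null Ω).IsGarblingOf σ := by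
  refine ⟨Kernel.const σ.Signal (Measure.dirac (PUnit.unit : (null Ω).Signal)), ⟨fun s => ?_⟩, ?_⟩
  · exact Measure.dirac.isProbabilityMeasure
  · exact (Kernel.const_comp' _ _).symm

end

variable {Ω : Type u} [MeasurableSpace Ω] [StandardBorelSpace Ω] [Nonempty Ω]

theorem measurable_posteriorBelief (σ : Experiment Ω) (μ : Belief Ω) :
    Measurable (σ.posteriorBelief μ) :=
  (Kernel.measurable (posterior σ.kernel (μ : Measure Ω))).subtype_mk

instance (σ : Experiment Ω) (μ : Belief Ω) : IsProbabilityMeasure (σ.posteriorLaw μ) :=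
  Measure.isProbabilityMeasure_map (σ.measurable_posteriorBelief μ).aemeasurable

theorem posteriorLaw_full (μ : Belief Ω) :
    (full Ω).posteriorLaw μ = (μ : Measure Ω).map pointBelief := by
  unfold posteriorLaw
  have h : (full Ω).kernel ∘ₘ (μ : Measure Ω) = (μ : Measure Ω) := Measure.id_comp
  rw [h]
  refine Measure.map_congr ?_
  filter_upwards [posterior_id (μ : Measure Ω)] with ω hω
  exact Subtype.ext (hω.trans (Kernel.id_apply ω))

/-- The posteriors average to the prior, and here only one of them has any weight. -/
theorem posteriorLaw_of_comp_eq_dirac {σ : Experiment Ω} {μ : Belief Ω} {s : σ.Signal}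
    (h : σ.kernel ∘ₘ (μ : Measure Ω) = Measure.dirac s) :
    σ.posteriorLaw μ = Measure.dirac μ := by
  unfold posteriorLaw
  rw [h, Measure.map_dirac' (σ.measurable_posteriorBelief μ)]
  congr 1
  refine Subtype.ext ?_
  have h2 : posterior σ.kernel (μ : Measure Ω) ∘ₘ σ.kernel ∘ₘ (μ : Measure Ω) = μ :=
    posterior_comp_self
  rw [h, Measure.dirac_bind (Kernel.measurable _)] at h2
  exact h2

theorem posteriorLaw_null (μ : Belief Ω) :
    (null Ω).posteriorLaw μ = Measure.dirac μ := by
  refine posteriorLaw_of_comp_eq_dirac (s := PUnit.unit) ?_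
  change Measure.bind (μ : Measure Ω) (fun _ => Measure.dirac (PUnit.unit : (null Ω).Signal)) = _
  rw [Measure.bind_const, measure_univ, one_smul]
  rfl

/-- The kernel that draws a state from a belief. -/
def drawState (Ω : Type u) [MeasurableSpace Ω] : Kernel (Belief Ω) Ω where
  toFun ν := ν
  measurable' := measurable_subtype_coe

instance : IsMarkovKernel (drawState Ω) := ⟨fun ν => ν.2⟩

/-- The posterior beliefs average to the prior belief. -/
theorem drawState_comp_posteriorLaw (τ : Experiment Ω) (μ : Belief Ω) :
    drawState Ω ∘ₘ τ.posteriorLaw μ = μ := by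
  have hbar : posterior τ.kernel (μ : Measure Ω) ∘ₘ τ.kernel ∘ₘ (μ : Measure Ω) = μ :=
    posterior_comp_self
  refine Eq.trans ?_ hbar
  unfold posteriorLaw
  ext s hs
  rw [Measure.bind_apply hs (Kernel.aemeasurable _), Measure.bind_apply hs (Kernel.aemeasurable _),
    lintegral_map (Kernel.measurable_coe _ hs) (τ.measurable_posteriorBelief μ)]
  rfl

theorem integrable_integral_posteriorLaw (τ : Experiment Ω) (μ : Belief Ω) {f : Ω → ℝ}
    (hf : Integrable f (μ : Measure Ω)) :
    Integrable (fun ν : Belief Ω => ∫ ω, f ω ∂(ν : Measure Ω)) (τ.posteriorLaw μ) := by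
  rw [← τ.drawState_comp_posteriorLaw μ, Measure.comp_eq_comp_const_apply] at hf
  exact hf.integral_comp

theorem integral_integral_posteriorLaw (τ : Experiment Ω) (μ : Belief Ω) {f : Ω → ℝ}
    (hf : Integrable f (μ : Measure Ω)) :
    ∫ ν, ∫ ω, f ω ∂((ν : Belief Ω) : Measure Ω) ∂(τ.posteriorLaw μ) =
      ∫ ω, f ω ∂(μ : Measure Ω) := by
  rw [← τ.drawState_comp_posteriorLaw μ, Measure.comp_eq_comp_const_apply] at hf
  have := Kernel.integral_comp hf
  rw [← Measure.comp_eq_comp_const_apply, τ.drawState_comp_posteriorLaw μ] at this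
  exact this.symm

end Experiment

end SellingData

/-! ### Optimal utilities as functions of the type -/

namespace SellingData

variable {Ω : Type u} [MeasurableSpace Ω] [StandardBorelSpace Ω] [Nonempty Ω]

/-- The expected value `E_{σ|μ} v`. -/
noncomputable def expectedValue (v : Belief Ω → ℝ) (σ : Experiment Ω) (μ : Belief Ω) : ℝ :=
  ∫ ν, v ν ∂(σ.posteriorLaw μ)

namespace BlackwellMonotoneAt

variable {v : Belief Ω → ℝ} {μ : Belief Ω}

theorem expectedValue_null (h : BlackwellMonotoneAt v μ) :
    expectedValue v (Experiment.null Ω) μ = v μ := by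
  have := h.1 (Experiment.null Ω)
  unfold expectedValue
  rw [Experiment.posteriorLaw_null] at this ⊢
  exact integral_dirac_of_integrable this

theorem expectedValue_le_full (h : BlackwellMonotoneAt v μ) (σ : Experiment Ω) :
    expectedValue v σ μ ≤ expectedValue v (Experiment.full Ω) μ :=
  h.2 _ _ σ.isGarblingOf_full

theorem le_expectedValue (h : BlackwellMonotoneAt v μ) (σ : Experiment Ω) :
    v μ ≤ expectedValue v σ μ := by
  rw [← h.expectedValue_null]
  exact h.2 _ _ σ.null_isGarblingOf

theorem integrable_pointBelief (h : BlackwellMonotoneAt v μ) :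
    Integrable (fun ω => v (pointBelief ω)) (μ : Measure Ω) := by
  have := h.1 (Experiment.full Ω)
  rw [Experiment.posteriorLaw_full] at this
  exact this.comp_measurable measurable_pointBelief

theorem expectedValue_full (h : BlackwellMonotoneAt v μ) :
    expectedValue v (Experiment.full Ω) μ = ∫ ω, v (pointBelief ω) ∂(μ : Measure Ω) := by
  have := h.1 (Experiment.full Ω)
  unfold expectedValue
  rw [Experiment.posteriorLaw_full] at this ⊢
  exact integral_map measurable_pointBelief.aemeasurable this.1

end BlackwellMonotoneAt

/-- `v` represents the separable valuation of the market and is Blackwell monotone at almost all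
beliefs that can arise. -/
structure Market.IsValueFunction (E : Market Ω) (v : Belief Ω → ℝ) : Prop where
  value_eq : ∀ μ θ, E.value μ θ = v μ * (θ : ℝ)
  ae_monotone : ∀ τ : Experiment Ω, ∀ᵐ μ ∂(τ.posteriorLaw E.prior), BlackwellMonotoneAt v μ

/-- Monotonicity passes to `v` by dividing by a positive type. If there is none, all types are 0,
nothing is known about `v`, and the zero function serves instead. -/
theorem Market.exists_isValueFunction (E : Market Ω) (hlo : 0 ≤ E.lo) (hsep : E.IsSeparable)
    (hV : E.IsBlackwellMonotone) : ∃ v, E.IsValueFunction v := by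
  obtain ⟨v, hv⟩ := hsep
  by_cases h : ∃ θ : Set.Icc E.lo E.hi, 0 < (θ : ℝ)
  · obtain ⟨θ, hθ⟩ := h
    refine ⟨v, hv, fun τ => ?_⟩
    filter_upwards [hV θ τ] with μ hμ
    have hfun : (fun ν => E.value ν θ) = fun ν => v ν * (θ : ℝ) := funext fun ν => hv ν θ
    rw [hfun] at hμ
    refine ⟨fun σ => ?_, fun σ τ hστ => ?_⟩
    · refine ((hμ.1 σ).mul_const (θ : ℝ)⁻¹).congr (Filter.Eventually.of_forall fun ν => ?_)
      simp [hθ.ne']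
    · have := hμ.2 σ τ hστ
      rw [integral_mul_const, integral_mul_const] at this
      exact le_of_mul_le_mul_right this hθ
  · push Not at h
    refine ⟨fun _ => 0, fun μ θ => ?_, fun τ => Filter.Eventually.of_forall fun μ =>
      ⟨fun σ => integrable_zero _ _ _, fun σ τ _ => by simp⟩⟩
    rw [hv, le_antisymm (h θ) (hlo.trans θ.2.1)]
    simp

namespace Market

variable {E : Market Ω} {v : Belief Ω → ℝ} {A : Set (Experiment Ω)}

theorem IsValueFunction.indirectValue_eq (h : E.IsValueFunction v) (A : Set (Experiment Ω))
    (μ : Belief Ω) (θ : Set.Icc E.lo E.hi) :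
    E.indirectValue A μ θ =
      ⨆ σ : A, (expectedValue v (σ : Experiment Ω) μ * (θ : ℝ) - E.cost σ μ) := by
  unfold indirectValue expectedValue
  congr 1
  ext σ
  rw [← integral_mul_const]
  simp only [h.value_eq]

section Pointwise

variable {μ : Belief Ω}

theorem IsAvailable.le_full (hA : E.IsAvailable A) (hlo : 0 ≤ E.lo)
    (hμ : BlackwellMonotoneAt v μ) (σ : A) (θ : Set.Icc E.lo E.hi) :
    expectedValue v (σ : Experiment Ω) μ * (θ : ℝ) - E.cost σ μ ≤
      expectedValue v (Experiment.full Ω) μ * (θ : ℝ) := by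
  have h1 := mul_le_mul_of_nonneg_right (hμ.expectedValue_le_full σ) (hlo.trans θ.2.1)
  have h2 := hA.cost_nonneg σ σ.2 μ
  linarith

/-- Full information bounds all the payoffs, so the real supremum is genuine and not the default
value of an unbounded family. -/
theorem IsAvailable.le_indirectValue (h : E.IsValueFunction v)
    (hA : E.IsAvailable A) (hlo : 0 ≤ E.lo) (hμ : BlackwellMonotoneAt v μ) (σ : A) (θ : Set.Icc E.lo E.hi) :
    expectedValue v (σ : Experiment Ω) μ * (θ : ℝ) - E.cost σ μ ≤ E.indirectValue A μ θ := by
  rw [h.indirectValue_eq]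
  refine le_ciSup (f := fun σ : A => expectedValue v (σ : Experiment Ω) μ * (θ : ℝ) - E.cost σ μ)
    ⟨expectedValue v (Experiment.full Ω) μ * (θ : ℝ), ?_⟩ σ
  rintro _ ⟨σ, rfl⟩
  exact hA.le_full hlo hμ σ θ

theorem IsAvailable.indirectValue_le_of (h : E.IsValueFunction v)
    (hA : E.IsAvailable A) {θ : Set.Icc E.lo E.hi} {c : ℝ}
    (hc : ∀ σ : A, expectedValue v (σ : Experiment Ω) μ * (θ : ℝ) - E.cost σ μ ≤ c) :
    E.indirectValue A μ θ ≤ c := by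
  rw [h.indirectValue_eq]
  have : Nonempty A := ⟨⟨_, hA.null_mem⟩⟩
  exact ciSup_le hc

theorem IsAvailable.indirectValue_le_full (h : E.IsValueFunction v)
    (hA : E.IsAvailable A) (hlo : 0 ≤ E.lo) (hμ : BlackwellMonotoneAt v μ) (θ : Set.Icc E.lo E.hi) :
    E.indirectValue A μ θ ≤ expectedValue v (Experiment.full Ω) μ * (θ : ℝ) :=
  hA.indirectValue_le_of h fun σ => hA.le_full hlo hμ σ θ

theorem IsAvailable.value_le_indirectValue (h : E.IsValueFunction v)
    (hA : E.IsAvailable A) (hlo : 0 ≤ E.lo) (hμ : BlackwellMonotoneAt v μ)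
    (hnull : ∀ μ, E.cost (Experiment.null Ω) μ = 0) (θ : Set.Icc E.lo E.hi) :
    v μ * (θ : ℝ) ≤ E.indirectValue A μ θ := by
  have := hA.le_indirectValue h hlo hμ ⟨_, hA.null_mem⟩ θ
  simpa [hμ.expectedValue_null, hnull] using this

/-- The payoff of each experiment is affine in the type, with slope at most the value of full
information. -/
theorem IsAvailable.indirectValue_lipschitz (h : E.IsValueFunction v)
    (hA : E.IsAvailable A) (hlo : 0 ≤ E.lo) (hμ : BlackwellMonotoneAt v μ) {θ θ' : Set.Icc E.lo E.hi} (hθ : θ ≤ θ') :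
    E.indirectValue A μ θ' ≤ E.indirectValue A μ θ +
      expectedValue v (Experiment.full Ω) μ * ((θ' : ℝ) - θ) := by
  refine hA.indirectValue_le_of h fun σ => ?_
  have h1 := hA.le_indirectValue h hlo hμ σ θ
  have h2 := mul_le_mul_of_nonneg_right (hμ.expectedValue_le_full σ)
    (sub_nonneg.2 (Subtype.coe_le_coe.2 hθ))
  linarith

/-- This is where nonnegative costs matter for the envelope: per unit of type, a payoff is the
expected value minus cost/θ, which is nondecreasing in θ. The product form also covers the type 0.
-/
theorem IsAvailable.indirectValue_scale (h : E.IsValueFunction v)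
    (hA : E.IsAvailable A) (hlo : 0 ≤ E.lo) (hμ : BlackwellMonotoneAt v μ) {θ θ' : Set.Icc E.lo E.hi} (hθ : θ ≤ θ') :
    (θ' : ℝ) * E.indirectValue A μ θ ≤ (θ : ℝ) * E.indirectValue A μ θ' := by
  have h0 : 0 ≤ (θ : ℝ) := hlo.trans θ.2.1
  have hle : (θ : ℝ) ≤ θ' := hθ
  rcases (h0.trans hle).eq_or_lt with h' | h'
  · have : (θ : ℝ) = 0 := le_antisymm (hle.trans h'.symm.le) h0
    simp [← h', this]
  rw [mul_comm, ← le_div_iff₀ h']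
  refine hA.indirectValue_le_of h fun σ => ?_
  rw [le_div_iff₀ h']
  have h1 := mul_le_mul_of_nonneg_left (hA.le_indirectValue h hlo hμ σ θ') h0
  have h2 := mul_le_mul_of_nonneg_right hle (hA.cost_nonneg σ σ.2 μ)
  linarith

theorem IsAvailable.indirectValue_convex (h : E.IsValueFunction v)
    (hA : E.IsAvailable A) (hlo : 0 ≤ E.lo) (hμ : BlackwellMonotoneAt v μ) {θ₁ θ₂ θ : Set.Icc E.lo E.hi} {a b : ℝ} (ha : 0 ≤ a)
    (hb : 0 ≤ b) (hab : a + b = 1) (hθ : (θ : ℝ) = a * θ₁ + b * θ₂) :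
    E.indirectValue A μ θ ≤ a * E.indirectValue A μ θ₁ + b * E.indirectValue A μ θ₂ := by
  refine hA.indirectValue_le_of h fun σ => ?_
  have h1 := mul_le_mul_of_nonneg_left (hA.le_indirectValue h hlo hμ σ θ₁) ha
  have h2 := mul_le_mul_of_nonneg_left (hA.le_indirectValue h hlo hμ σ θ₂) hb
  have h3 : E.cost σ μ = a * E.cost σ μ + b * E.cost σ μ := by rw [← add_mul, hab, one_mul]
  rw [hθ]
  linarith

end Pointwise

theorem IsValueFunction.indirectValue_null (h : E.IsValueFunction v)
    (hnull : ∀ μ, E.cost (Experiment.null Ω) μ = 0) {μ : Belief Ω} (hμ : BlackwellMonotoneAt v μ)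
    (θ : Set.Icc E.lo E.hi) :
    E.indirectValue {Experiment.null Ω} μ θ = v μ * (θ : ℝ) := by
  rw [h.indirectValue_eq, ciSup_unique]
  change expectedValue v (Experiment.null Ω) μ * (θ : ℝ) - E.cost (Experiment.null Ω) μ = _
  rw [hμ.expectedValue_null, hnull, sub_zero]

/-- The null experiment leaves an atom at the prior, so the almost-everywhere assumption holds there
exactly. -/
theorem IsValueFunction.monotone_prior (h : E.IsValueFunction v) :
    BlackwellMonotoneAt v E.prior := by
  have := h.ae_monotone (Experiment.null Ω)
  rw [Experiment.posteriorLaw_null] at this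
  exact of_ae_dirac this

theorem IsValueFunction.isAvailable_null (h : E.IsValueFunction v)
    (hnull : ∀ μ, E.cost (Experiment.null Ω) μ = 0) : E.IsAvailable {Experiment.null Ω} where
  null_mem := rfl
  cost_nonneg := by rintro σ rfl μ; exact (hnull μ).ge
  integrable θ τ := by
    refine ((h.monotone_prior.1 τ).mul_const (θ : ℝ)).congr ?_
    filter_upwards [h.ae_monotone τ] with μ hμ
    exact (h.indirectValue_null hnull hμ θ).symm

theorem IsValueFunction.integrable_full (h : E.IsValueFunction v) (τ : Experiment Ω) :
    Integrable (expectedValue v (Experiment.full Ω)) (τ.posteriorLaw E.prior) := by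
  refine (τ.integrable_integral_posteriorLaw E.prior
    h.monotone_prior.integrable_pointBelief).congr ?_
  filter_upwards [h.ae_monotone τ] with μ hμ
  exact hμ.expectedValue_full.symm

/-- The value of full information is linear in the belief, and posteriors average to the prior. -/
theorem IsValueFunction.integral_full (h : E.IsValueFunction v) (τ : Experiment Ω) :
    ∫ μ, expectedValue v (Experiment.full Ω) μ ∂(τ.posteriorLaw E.prior) =
      expectedValue v (Experiment.full Ω) E.prior := by
  rw [h.monotone_prior.expectedValue_full,
    ← τ.integral_integral_posteriorLaw E.prior h.monotone_prior.integrable_pointBelief]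
  refine integral_congr_ae ?_
  filter_upwards [h.ae_monotone τ] with μ hμ
  exact hμ.expectedValue_full

/-- The expected optimal utility of type `θ` after the experiment `τ`. -/
noncomputable def grossValue (E : Market Ω) (A : Set (Experiment Ω)) (τ : Experiment Ω)
    (θ : Set.Icc E.lo E.hi) : ℝ :=
  ∫ μ, E.indirectValue A μ θ ∂(τ.posteriorLaw E.prior)

section Integrated

theorem IsAvailable.grossValue_le (h : E.IsValueFunction v)
    (hA : E.IsAvailable A) (hlo : 0 ≤ E.lo) (τ : Experiment Ω) (θ : Set.Icc E.lo E.hi) :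
    E.grossValue A τ θ ≤ expectedValue v (Experiment.full Ω) E.prior * (θ : ℝ) := by
  rw [← h.integral_full τ, ← integral_mul_const]
  refine integral_mono_ae (hA.integrable θ τ) ((h.integrable_full τ).mul_const _) ?_
  filter_upwards [h.ae_monotone τ] with μ hμ
  exact hA.indirectValue_le_full h hlo hμ θ

theorem IsAvailable.expectedValue_le_grossValue (h : E.IsValueFunction v)
    (hA : E.IsAvailable A) (hlo : 0 ≤ E.lo) (τ : Experiment Ω)
    (hnull : ∀ μ, E.cost (Experiment.null Ω) μ = 0) (θ : Set.Icc E.lo E.hi) :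
    expectedValue v τ E.prior * (θ : ℝ) ≤ E.grossValue A τ θ := by
  unfold expectedValue
  rw [← integral_mul_const]
  refine integral_mono_ae ((h.monotone_prior.1 τ).mul_const _) (hA.integrable θ τ) ?_
  filter_upwards [h.ae_monotone τ] with μ hμ
  exact hA.value_le_indirectValue h hlo hμ hnull θ

theorem IsAvailable.grossValue_lipschitz (h : E.IsValueFunction v)
    (hA : E.IsAvailable A) (hlo : 0 ≤ E.lo) (τ : Experiment Ω) {θ θ' : Set.Icc E.lo E.hi} (hθ : θ ≤ θ') :
    E.grossValue A τ θ' ≤ E.grossValue A τ θ +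
      expectedValue v (Experiment.full Ω) E.prior * ((θ' : ℝ) - θ) := by
  unfold grossValue
  rw [← h.integral_full τ, ← integral_mul_const, ← integral_add (hA.integrable θ τ)
    ((h.integrable_full τ).mul_const _)]
  refine integral_mono_ae (hA.integrable θ' τ)
    ((hA.integrable θ τ).add ((h.integrable_full τ).mul_const _)) ?_
  filter_upwards [h.ae_monotone τ] with μ hμ
  exact hA.indirectValue_lipschitz h hlo hμ hθ

theorem IsAvailable.grossValue_scale (h : E.IsValueFunction v)
    (hA : E.IsAvailable A) (hlo : 0 ≤ E.lo) (τ : Experiment Ω) {θ θ' : Set.Icc E.lo E.hi} (hθ : θ ≤ θ') :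
    (θ' : ℝ) * E.grossValue A τ θ ≤ (θ : ℝ) * E.grossValue A τ θ' := by
  unfold grossValue
  rw [← integral_const_mul, ← integral_const_mul]
  refine integral_mono_ae ((hA.integrable θ τ).const_mul _) ((hA.integrable θ' τ).const_mul _) ?_
  filter_upwards [h.ae_monotone τ] with μ hμ
  exact hA.indirectValue_scale h hlo hμ hθ

theorem IsAvailable.grossValue_convex (h : E.IsValueFunction v)
    (hA : E.IsAvailable A) (hlo : 0 ≤ E.lo) (τ : Experiment Ω) {θ₁ θ₂ θ : Set.Icc E.lo E.hi} {a b : ℝ} (ha : 0 ≤ a)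
    (hb : 0 ≤ b) (hab : a + b = 1) (hθ : (θ : ℝ) = a * θ₁ + b * θ₂) :
    E.grossValue A τ θ ≤ a * E.grossValue A τ θ₁ + b * E.grossValue A τ θ₂ := by
  unfold grossValue
  rw [← integral_const_mul, ← integral_const_mul, ← integral_add
    ((hA.integrable θ₁ τ).const_mul _) ((hA.integrable θ₂ τ).const_mul _)]
  refine integral_mono_ae (hA.integrable θ τ) (((hA.integrable θ₁ τ).const_mul _).add
    ((hA.integrable θ₂ τ).const_mul _)) ?_
  filter_upwards [h.ae_monotone τ] with μ hμ
  exact hA.indirectValue_convex h hlo hμ ha hb hab hθ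

end Integrated

theorem IsValueFunction.grossValue_null (h : E.IsValueFunction v)
    (hnull : ∀ μ, E.cost (Experiment.null Ω) μ = 0) (τ : Experiment Ω)
    (θ : Set.Icc E.lo E.hi) :
    E.grossValue {Experiment.null Ω} τ θ = expectedValue v τ E.prior * (θ : ℝ) := by
  unfold grossValue expectedValue
  rw [← integral_mul_const]
  refine integral_congr_ae ?_
  filter_upwards [h.ae_monotone τ] with μ hμ
  exact h.indirectValue_null hnull hμ θ

end Market

/-! ### Degenerate lotteries over experiments -/

namespace Experiment

theorem isGarblingOf_of_map {Ω : Type u} [MeasurableSpace Ω] {σ τ : Experiment Ω}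
    {g : τ.Signal → σ.Signal} (hg : Measurable g)
    (h : ∀ ω s, MeasurableSet s → σ.kernel ω s = τ.kernel ω (g ⁻¹' s)) : σ.IsGarblingOf τ := by
  refine ⟨Kernel.deterministic g hg, Kernel.isMarkovKernel_deterministic hg, ?_⟩
  ext ω s hs
  rw [h ω s hs, Kernel.deterministic_comp_eq_map, Kernel.map_apply' _ hg _ hs]

end Experiment

namespace RandomExperiment

variable {Ω : Type u} [MeasurableSpace Ω]

/-- The lottery that always announces the experiment `σ`. -/
noncomputable def sure (σ : Experiment Ω) : RandomExperiment Ω where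
  Index := PUnit
  law := Measure.dirac PUnit.unit
  Signal := σ.Signal
  kernel := σ.kernel.comap Prod.fst measurable_fst

theorem observed_sure_kernel_apply (σ : Experiment Ω) (ω : Ω) {s : Set (PUnit × σ.Signal)}
    (hs : MeasurableSet s) :
    (Kernel.const Ω (Measure.dirac PUnit.unit) ⊗ₖ σ.kernel.comap Prod.fst measurable_fst :
      Kernel Ω (PUnit × σ.Signal)) ω s = σ.kernel ω (Prod.mk PUnit.unit ⁻¹' s) := by
  rw [Kernel.compProd_apply hs, Kernel.const_apply, lintegral_dirac]
  rfl

theorem isGarblingOf_observed_sure (σ : Experiment Ω) : σ.IsGarblingOf (sure σ).observed := by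
  refine Experiment.isGarblingOf_of_map (σ := σ) (τ := (sure σ).observed)
    (g := (Prod.snd : PUnit × σ.Signal → σ.Signal)) measurable_snd fun ω s hs => ?_
  exact (observed_sure_kernel_apply σ ω (measurable_snd hs)).symm

theorem observed_sure_isGarblingOf (σ : Experiment Ω) : (sure σ).observed.IsGarblingOf σ := by
  have hm : Measurable (Prod.mk PUnit.unit : σ.Signal → PUnit × σ.Signal) := by fun_prop
  exact Experiment.isGarblingOf_of_map (σ := (sure σ).observed) (τ := σ) hm
    fun ω s hs => observed_sure_kernel_apply σ ω hs

end RandomExperiment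

end SellingData

/-! ### Monopoly types -/

namespace SellingData

section MonopolyType

variable {Ω : Type u} [MeasurableSpace Ω] (E : Market Ω) [IsProbabilityMeasure E.typeLaw]

theorem Market.nonempty_types : Nonempty (Set.Icc E.lo E.hi) :=
  nonempty_of_isProbabilityMeasure E.typeLaw

theorem Market.lo_le_hi : E.lo ≤ E.hi :=
  let ⟨θ⟩ := E.nonempty_types
  θ.2.1.trans θ.2.2

/-- Atoms of the type law make the tail jump down only just to the right of a price. Tails at prices
near `θ` lie in a set `S n` slightly larger than the tail at `θ`. -/
theorem Market.upperSemicontinuous_priceRevenue (hlo : 0 ≤ E.lo) :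
    UpperSemicontinuous E.priceRevenue := by
  intro θ c hc
  set S : ℕ → Set (Set.Icc E.lo E.hi) := fun n => {x | (θ : ℝ) - 1 / ((n : ℝ) + 1) ≤ x} with hS
  have hSm : ∀ n, MeasurableSet (S n) := fun n =>
    measurableSet_le measurable_const measurable_subtype_coe
  have hanti : Antitone S := by
    intro n k hnk x hx
    refine le_trans ?_ (show (θ : ℝ) - 1 / ((k : ℝ) + 1) ≤ x from hx)
    have : 1 / ((k : ℝ) + 1) ≤ 1 / ((n : ℝ) + 1) := Nat.one_div_le_one_div hnk
    linarith
  have hinter : ⋂ n, S n = Set.Ici θ := by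
    ext x
    simp only [Set.mem_iInter, hS, Set.mem_ofPred_eq, Set.mem_Ici]
    refine ⟨fun h => ?_, fun h n => ?_⟩
    · have lim := (tendsto_one_div_add_atTop_nhds_zero_nat (𝕜 := ℝ)).const_sub (θ : ℝ)
      rw [sub_zero] at lim
      exact Subtype.coe_le_coe.1 (le_of_tendsto' lim h)
    · have h1 : (θ : ℝ) ≤ x := h
      have : (0 : ℝ) ≤ 1 / ((n : ℝ) + 1) := by positivity
      linarith
  have lim : Filter.Tendsto (fun n => (θ : ℝ) * E.typeLaw.real (S n)) Filter.atTop
      (nhds (E.priceRevenue θ)) := by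
    have := tendsto_measure_iInter_atTop (μ := E.typeLaw) (fun n => (hSm n).nullMeasurableSet)
      hanti ⟨0, measure_ne_top _ _⟩
    rw [hinter] at this
    exact (((ENNReal.tendsto_toReal (measure_ne_top _ _)).comp this).const_mul _)
  obtain ⟨n, hn⟩ := (lim.eventually (gt_mem_nhds hc)).exists
  have h1 : ∀ᶠ y : Set.Icc E.lo E.hi in nhds θ, (y : ℝ) * E.typeLaw.real (S n) < c :=
    (continuous_subtype_val.mul continuous_const).continuousAt.eventually (gt_mem_nhds hn)
  have h2 : ∀ᶠ y : Set.Icc E.lo E.hi in nhds θ, (θ : ℝ) - 1 / ((n : ℝ) + 1) < y := by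
    refine continuous_subtype_val.continuousAt.eventually (lt_mem_nhds ?_)
    have : (0 : ℝ) < 1 / ((n : ℝ) + 1) := by positivity
    linarith
  filter_upwards [h1, h2] with y hy1 hy2
  refine lt_of_le_of_lt ?_ hy1
  refine mul_le_mul_of_nonneg_left (measureReal_mono fun x hx => ?_) (hlo.trans y.2.1)
  exact hy2.le.trans hx

theorem Market.isCompact_monopolyTypes (hlo : 0 ≤ E.lo) :
    IsCompact {θ | E.IsMonopolyType θ} := by
  have : {θ | E.IsMonopolyType θ} = ⋂ z, E.priceRevenue ⁻¹' Set.Ici (E.priceRevenue z) := by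
    ext θ; simp [Market.IsMonopolyType]
  rw [this]
  exact (isClosed_iInter fun z =>
    (E.upperSemicontinuous_priceRevenue hlo).isClosed_preimage _).isCompact

theorem Market.nonempty_monopolyTypes (hlo : 0 ≤ E.lo) :
    {θ | E.IsMonopolyType θ}.Nonempty := by
  have := E.nonempty_types
  obtain ⟨θ, -, hθ⟩ := UpperSemicontinuousOn.exists_isMaxOn (s := Set.univ) Set.univ_nonempty
    isCompact_univ ((E.upperSemicontinuous_priceRevenue hlo).upperSemicontinuousOn Set.univ)
  exact ⟨θ, fun z => hθ (Set.mem_univ z)⟩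

theorem Market.IsMonopolyType.lt_of_not {E : Market Ω} {θ z : Set.Icc E.lo E.hi}
    (hθ : E.IsMonopolyType θ) (hz : ¬ E.IsMonopolyType z) :
    E.priceRevenue z < E.priceRevenue θ := by
  unfold Market.IsMonopolyType at hz
  push Not at hz
  obtain ⟨y, hy⟩ := hz
  exact hy.trans_le (hθ y)

end MonopolyType

section TruncatedTypes

variable {Ω : Type u} [MeasurableSpace Ω] {E : Market Ω}

/-- Prices above `a` lose no buyers when the types below `a` are discarded, so the monopoly bound
carries over to the truncated law. -/
theorem restrict_mul_real {a : Set.Icc E.lo E.hi} {z : ℝ} (hz : z ∈ Set.Icc (a : ℝ) E.hi) :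
    z * (E.typeLaw.restrict (Set.Ici a)).real {y | z ≤ y} =
      E.priceRevenue ⟨z, a.2.1.trans hz.1, hz.2⟩ := by
  unfold Market.priceRevenue
  rw [measureReal_restrict_apply (measurableSet_le measurable_const measurable_subtype_coe)]
  congr 2
  ext y
  exact ⟨fun hy => hy.1, fun hy => ⟨hy, hz.1.trans hy⟩⟩

theorem ae_mem_Icc (a : Set.Icc E.lo E.hi) :
    ∀ᵐ y : Set.Icc E.lo E.hi ∂(E.typeLaw.restrict (Set.Ici a)),
      (y : ℝ) ∈ Set.Icc (a : ℝ) E.hi := by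
  filter_upwards [ae_restrict_mem measurableSet_Ici] with y hy
  exact ⟨hy, y.2.2⟩

end TruncatedTypes

/-! ### Envelope bound on payments, and its equality case -/

/-- Net utility `w` (in excess of the value of the prior) and marginal allocation `D` of an
incentive compatible mechanism with values `x` and payments `p`. -/
structure IsEnvelope {lo hi : ℝ} (x p : Set.Icc lo hi → ℝ) (v₀ v₁ : ℝ) (w D : ℝ → ℝ) : Prop where
  w_eq : ∀ θ : Set.Icc lo hi, w θ = x θ - p θ - v₀ * θ
  mono : Monotone D
  nonneg : ∀ z, 0 ≤ D z
  le : ∀ z, D z ≤ v₁ - v₀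
  right_support : ∀ z y, lo ≤ z → z ≤ y → y ≤ hi → w z + D z * (y - z) ≤ w y
  left_support : ∀ z y, lo ≤ z → z < y → y < hi → w y ≤ w z + D y * (y - z)
  value_le : ∀ θ : Set.Icc lo hi, x θ - v₀ * θ ≤ θ * D θ
  w_mono : ∀ z y, lo ≤ z → z ≤ y → y ≤ hi → w z ≤ w y
  w_lipschitz : ∀ z y, lo ≤ z → z ≤ y → y ≤ hi → w y ≤ w z + (v₁ - v₀) * (y - z)

namespace IsEnvelope

variable {Ω : Type u} [MeasurableSpace Ω] {E : Market Ω} [IsProbabilityMeasure E.typeLaw]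
  {x p : Set.Icc E.lo E.hi → ℝ} {v₀ v₁ : ℝ} {w D : ℝ → ℝ}

theorem gap_nonneg {lo hi : ℝ} {x p : Set.Icc lo hi → ℝ} (h : IsEnvelope x p v₀ v₁ w D) :
    0 ≤ v₁ - v₀ :=
  (h.nonneg 0).trans (h.le 0)

theorem integrable_w (h : IsEnvelope x p v₀ v₁ w D) :
    Integrable (fun θ : Set.Icc E.lo E.hi => w θ) E.typeLaw := by
  have hm : Monotone fun θ : Set.Icc E.lo E.hi => w θ := fun θ θ' hθ =>
    h.w_mono θ θ' θ.2.1 hθ θ'.2.2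
  refine Integrable.of_bound hm.measurable.aestronglyMeasurable (max |w E.lo| |w E.hi|)
    (Filter.Eventually.of_forall fun θ => ?_)
  exact abs_le_max_abs_abs (h.w_mono _ _ le_rfl θ.2.1 θ.2.2) (h.w_mono _ _ θ.2.1 θ.2.2 le_rfl)

theorem integrable_type : Integrable (fun θ : Set.Icc E.lo E.hi => (θ : ℝ)) E.typeLaw :=
  Integrable.of_bound measurable_subtype_coe.aestronglyMeasurable (max |E.lo| |E.hi|)
    (Filter.Eventually.of_forall fun θ => abs_le_max_abs_abs θ.2.1 θ.2.2)

theorem integrable_mul_D (h : IsEnvelope x p v₀ v₁ w D) :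
    Integrable (fun θ : Set.Icc E.lo E.hi => (θ : ℝ) * D θ) E.typeLaw := by
  refine integrable_type.mul_bdd (c := v₁ - v₀)
    (h.mono.measurable.comp measurable_subtype_coe).aestronglyMeasurable
    (Filter.Eventually.of_forall fun θ => ?_)
  exact (Real.norm_of_nonneg (h.nonneg _)).le.trans (h.le _)

theorem integrable_utility (h : IsEnvelope x p v₀ v₁ w D) :
    Integrable (fun θ => x θ - p θ) E.typeLaw :=
  (h.integrable_w.add (integrable_type.const_mul v₀)).congr
    (Filter.Eventually.of_forall fun θ => by
      simp only [Pi.add_apply, h.w_eq]; ring)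

theorem integrable_value (h : IsEnvelope x p v₀ v₁ w D) (hp : Integrable p E.typeLaw) :
    Integrable x E.typeLaw :=
  (h.integrable_utility.add hp).congr (Filter.Eventually.of_forall fun θ => by simp)

theorem integrable_layers (h : IsEnvelope x p v₀ v₁ w D) (a : Set.Icc E.lo E.hi) :
    Integrable (fun θ : Set.Icc E.lo E.hi => (θ : ℝ) * D θ - (w θ - w a))
      (E.typeLaw.restrict (Set.Ici a)) :=
  (h.integrable_mul_D.sub (h.integrable_w.sub (integrable_const _))).restrict

theorem setIntegral_pay_add_le (h : IsEnvelope x p v₀ v₁ w D) (hp : Integrable p E.typeLaw)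
    (a : Set.Icc E.lo E.hi) :
    ∫ θ in Set.Ici a, p θ ∂E.typeLaw + w a * E.typeLaw.real (Set.Ici a) ≤
      ∫ θ in Set.Ici a, ((θ : ℝ) * D θ - (w θ - w a)) ∂E.typeLaw := by
  have : w a * E.typeLaw.real (Set.Ici a) = ∫ _ in Set.Ici a, w a ∂E.typeLaw := by
    simp [mul_comm]
  rw [this, ← integral_add hp.restrict (integrable_const _)]
  refine integral_mono (hp.restrict.add (integrable_const _)) (h.integrable_layers a) fun θ => ?_
  have h1 := h.w_eq θ
  have h2 := h.value_le θ
  simp only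
  linarith

/-- The payments of the types above `a` are bounded by the revenue of a monopoly price. -/
theorem setIntegral_pay_le (h : IsEnvelope x p v₀ v₁ w D) (hlo : 0 ≤ E.lo)
    (hp : Integrable p E.typeLaw) (a : Set.Icc E.lo E.hi) {m : Set.Icc E.lo E.hi}
    (hm : E.IsMonopolyType m) :
    ∫ θ in Set.Ici a, p θ ∂E.typeLaw + w a * E.typeLaw.real (Set.Ici a) ≤
      (v₁ - v₀) * E.priceRevenue m := by
  refine (h.setIntegral_pay_add_le hp a).trans ?_
  refine integral_envelope_le h.gap_nonneg h.mono h.nonneg h.le (hlo.trans a.2.1) a.2.2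
    measurable_subtype_coe (ae_mem_Icc a)
    (fun z y hz hzy hy => h.right_support z y (a.2.1.trans hz) hzy hy) (h.integrable_layers a) ?_
  intro z hz
  rw [restrict_mul_real hz]
  exact hm _

theorem ae_layer (h : IsEnvelope x p v₀ v₁ w D) (hlo : 0 ≤ E.lo)
    (hp : Integrable p E.typeLaw) (a : Set.Icc E.lo E.hi) {m : Set.Icc E.lo E.hi}
    (hm : E.IsMonopolyType m)
    (heq : (v₁ - v₀) * E.priceRevenue m ≤
      ∫ θ in Set.Ici a, p θ ∂E.typeLaw + w a * E.typeLaw.real (Set.Ici a)) :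
    ∀ᵐ t ∂(volume.restrict (Set.Ioo 0 (v₁ - v₀))),
      firstAbove D a E.hi t * (E.typeLaw.restrict (Set.Ici a)).real
        {y : Set.Icc E.lo E.hi | t < D y} =
        E.priceRevenue m := by
  refine ae_layer_eq h.gap_nonneg h.mono h.nonneg h.le (hlo.trans a.2.1) a.2.2
    measurable_subtype_coe (ae_mem_Icc a)
    (fun z y hz hzy hy => h.right_support z y (a.2.1.trans hz) hzy hy) (h.integrable_layers a) ?_
    (heq.trans (h.setIntegral_pay_add_le hp a))
  intro z hz
  rw [restrict_mul_real hz]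
  exact hm _

/-- Attaining the bound leaves no slack in the pointwise estimate of the payments by the envelope.
-/
theorem ae_value_eq (h : IsEnvelope x p v₀ v₁ w D) (hlo : 0 ≤ E.lo)
    (hp : Integrable p E.typeLaw) (a : Set.Icc E.lo E.hi) {m : Set.Icc E.lo E.hi}
    (hm : E.IsMonopolyType m)
    (heq : (v₁ - v₀) * E.priceRevenue m ≤
      ∫ θ in Set.Ici a, p θ ∂E.typeLaw + w a * E.typeLaw.real (Set.Ici a)) :
    ∀ᵐ θ ∂E.typeLaw, a ≤ θ → x θ - v₀ * θ = θ * D θ := by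
  refine (ae_restrict_iff' (s := Set.Ici a) measurableSet_Ici).1 ?_
  have hle : (fun θ => p θ + w a) ≤ᵐ[E.typeLaw.restrict (Set.Ici a)]
      fun θ => (θ : ℝ) * D θ - (w θ - w a) := Filter.Eventually.of_forall fun θ => by
    have h1 := h.w_eq θ
    have h2 := h.value_le θ
    simp only
    linarith
  have hpi : Integrable (fun θ => p θ + w a) (E.typeLaw.restrict (Set.Ici a)) :=
    hp.restrict.add (integrable_const _)
  have hI : ∫ θ in Set.Ici a, (p θ + w a) ∂E.typeLaw =
      ∫ θ in Set.Ici a, ((θ : ℝ) * D θ - (w θ - w a)) ∂E.typeLaw := by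
    refine le_antisymm (integral_mono_ae hpi (h.integrable_layers a) hle) ?_
    have h1 : ∫ θ in Set.Ici a, ((θ : ℝ) * D θ - (w θ - w a)) ∂E.typeLaw ≤
        (v₁ - v₀) * E.priceRevenue m := by
      refine integral_envelope_le h.gap_nonneg h.mono h.nonneg h.le (hlo.trans a.2.1) a.2.2
        measurable_subtype_coe (ae_mem_Icc a)
        (fun z y hz hzy hy => h.right_support z y (a.2.1.trans hz) hzy hy)
        (h.integrable_layers a) ?_
      intro z hz
      rw [restrict_mul_real hz]
      exact hm _
    refine (h1.trans heq).trans (le_of_eq ?_)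
    rw [integral_add hp.restrict (integrable_const _)]
    simp [mul_comm]
  filter_upwards [(integral_eq_iff_of_ae_le hpi (h.integrable_layers a) hle).1 hI] with θ hθ
  have h1 := h.w_eq θ
  linarith

/-- If the payments above the greatest monopoly type `a` attain the bound, then the types above
`a` are fully informed. -/
theorem top_of_attains (h : IsEnvelope x p v₀ v₁ w D) (hlo : 0 ≤ E.lo)
    (hp : Integrable p E.typeLaw) {a : Set.Icc E.lo E.hi}
    (ha : IsGreatest {θ | E.IsMonopolyType θ} a)
    (heq : (v₁ - v₀) * E.priceRevenue a ≤
      ∫ θ in Set.Ici a, p θ ∂E.typeLaw + w a * E.typeLaw.real (Set.Ici a)) :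
    (∀ θ : Set.Icc E.lo E.hi, a ≤ θ → w a + (v₁ - v₀) * ((θ : ℝ) - a) ≤ w θ) ∧
      ∀ᵐ θ ∂E.typeLaw, a ≤ θ → x θ = v₁ * θ := by
  have hae := h.ae_layer hlo hp a ha.1 heq
  have hlt : ∀ z (hz : z ∈ Set.Ioc (a : ℝ) E.hi),
      z * (E.typeLaw.restrict (Set.Ici a)).real {y | z ≤ y} < E.priceRevenue a := by
    intro z hz
    rw [restrict_mul_real ⟨hz.1.le, hz.2⟩]
    refine ha.1.lt_of_not fun hmon => ?_
    exact absurd (ha.2 hmon) (not_le.2 (Subtype.coe_lt_coe.1 hz.1))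
  have ha0 : 0 ≤ (a : ℝ) := hlo.trans a.2.1
  have hD : ∀ z ∈ Set.Ioc (a : ℝ) E.hi, D z = v₁ - v₀ := by
    intro z hz
    refine eq_top_of_ae_layer h.mono h.nonneg h.le ha0 a.2.2 (ae_mem_Icc a) hae ⟨hz.1.le, hz.2⟩
      ?_ fun y hy => hlt y ⟨hz.1.trans hy.1, hy.2⟩
    refine lt_of_le_of_lt ?_ (hlt z hz)
    exact mul_le_mul_of_nonneg_left (measureReal_mono fun y hy => (show z < (y : ℝ) from hy).le)
      (ha0.trans hz.1.le)
  constructor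
  · intro θ hθ
    have h1 := integral_le_of_right_support (w := w) (Subtype.coe_le_coe.2 hθ) h.mono
      (fun z y hz hzy hy => h.right_support z y (a.2.1.trans hz) hzy (hy.trans θ.2.2))
    have h2 : ∫ z in (a : ℝ)..θ, D z = (v₁ - v₀) * ((θ : ℝ) - a) := by
      rw [intervalIntegral.integral_of_le (Subtype.coe_le_coe.2 hθ),
        setIntegral_congr_fun (g := fun _ => v₁ - v₀) measurableSet_Ioc
          (fun z hz => hD z ⟨hz.1, hz.2.trans θ.2.2⟩)]
      simp [Subtype.coe_le_coe.2 hθ, mul_comm]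
    linarith
  -- The type `a` itself counts only if it is an atom. If moreover it is positive, excluding it
  -- strictly lowers the revenue, which forces `D a` to the top.
  · have hatom : (a : ℝ) * E.typeLaw.real {a} = 0 ∨ D a = v₁ - v₀ := by
      rcases (mul_nonneg ha0 (measureReal_nonneg (μ := E.typeLaw) (s := {a}))).eq_or_lt with h0 | h0
      · exact Or.inl h0.symm
      · refine Or.inr (eq_top_of_ae_layer h.mono h.nonneg h.le ha0 a.2.2 (ae_mem_Icc a) hae
          ⟨le_rfl, a.2.2⟩ ?_ hlt)
        have hs : Set.Ici a = {a} ∪ Set.Ioi a := by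
          ext y; simp [le_iff_eq_or_lt]
        have h1 : E.typeLaw.real (Set.Ici a) =
            E.typeLaw.real {a} + E.typeLaw.real (Set.Ioi a) := by
          rw [hs, measureReal_union (by simp) measurableSet_Ioi]
        have h2 : (E.typeLaw.restrict (Set.Ici a)).real {y | (a : ℝ) < y} =
            E.typeLaw.real (Set.Ioi a) := by
          rw [measureReal_restrict_apply
            (measurableSet_lt measurable_const measurable_subtype_coe)]
          congr 1
          ext y
          exact ⟨fun hy => hy.1, fun hy => ⟨hy, (show a < y from hy).le⟩⟩
        rw [h2]
        unfold Market.priceRevenue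
        rw [h1]
        linarith
    have hne : ∀ᵐ θ ∂E.typeLaw, θ = a → (a : ℝ) = 0 ∨ D a = v₁ - v₀ := by
      rcases hatom with h0 | h0
      · rcases mul_eq_zero.1 h0 with h1 | h1
        · exact Filter.Eventually.of_forall fun _ _ => Or.inl h1
        · have h2 : E.typeLaw {a} = 0 := by
            simpa [measureReal_def, ENNReal.toReal_eq_zero_iff] using h1
          have h3 : ∀ᵐ θ ∂E.typeLaw, θ ∉ ({a} : Set _) := measure_eq_zero_iff_ae_notMem.1 h2
          filter_upwards [h3] with θ hθ hθa
          exact absurd hθa hθ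
      · exact Filter.Eventually.of_forall fun _ _ => Or.inr h0
    filter_upwards [h.ae_value_eq hlo hp a ha.1 heq, hne] with θ h1 h2 hθ
    have h1 := h1 hθ
    rcases hθ.eq_or_lt with rfl | hlt'
    · rcases h2 rfl with h0 | h0
      · rw [h0] at h1 ⊢
        linarith
      · rw [h0] at h1
        linarith
    · rw [hD θ ⟨hlt', θ.2.2⟩] at h1
      linarith

/-- If the total payments attain the bound and the participation constraint is met, then the types
below the least monopoly type get nothing. -/
theorem bot_of_attains (h : IsEnvelope x p v₀ v₁ w D) (hlo : 0 ≤ E.lo)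
    (hp : Integrable p E.typeLaw) (hw0 : ∀ θ : Set.Icc E.lo E.hi, 0 ≤ w θ)
    {m : Set.Icc E.lo E.hi} (hm : IsLeast {θ | E.IsMonopolyType θ} m)
    (heq : (v₁ - v₀) * E.priceRevenue m ≤ ∫ θ, p θ ∂E.typeLaw) :
    (∀ θ : Set.Icc E.lo E.hi, θ ≤ m → w θ ≤ 0) ∧
      ∀ θ : Set.Icc E.lo E.hi, θ < m → x θ ≤ v₀ * θ := by
  have hle := E.lo_le_hi
  set a : Set.Icc E.lo E.hi := ⟨E.lo, le_rfl, hle⟩ with ha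
  have hIci : Set.Ici a = Set.univ := by
    ext y; exact ⟨fun _ => trivial, fun _ => y.2.1⟩
  have hub := h.setIntegral_pay_le hlo hp a hm.1
  have heq' : (v₁ - v₀) * E.priceRevenue m ≤
      ∫ θ in Set.Ici a, p θ ∂E.typeLaw + w a * E.typeLaw.real (Set.Ici a) := by
    rw [hIci, Measure.restrict_univ, probReal_univ]
    linarith [hw0 a]
  -- The payments alone already reach the bound for payments plus the rent of the lowest type.
  have hwa : w a ≤ 0 := by
    rw [hIci, Measure.restrict_univ, probReal_univ] at hub
    linarith
  have hae := h.ae_layer hlo hp a hm.1 heq'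
  have hD : ∀ θ : Set.Icc E.lo E.hi, θ < m → D θ = 0 := by
    intro θ hθ
    refine eq_zero_of_ae_layer h.nonneg h.le (hlo.trans a.2.1) a.2.2 (ae_mem_Icc a) hae θ.2.1 ?_
    intro z hz
    rw [restrict_mul_real ⟨hz.1, hz.2.trans θ.2.2⟩]
    refine hm.1.lt_of_not fun hmon => ?_
    exact absurd (hm.2 hmon) (not_le.2 (lt_of_le_of_lt (Subtype.coe_le_coe.1 hz.2) hθ))
  have hlow : ∀ θ : Set.Icc E.lo E.hi, θ < m → w θ ≤ 0 := by
    intro θ hθ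
    rcases θ.2.1.eq_or_lt with h0 | h0
    · rw [← h0]; exact hwa
    · have := h.left_support E.lo θ le_rfl h0 (lt_of_lt_of_le hθ m.2.2)
      rw [hD θ hθ, zero_mul, add_zero] at this
      exact this.trans hwa
  refine ⟨fun θ hθ => ?_, fun θ hθ => ?_⟩
  · rcases hθ.eq_or_lt with rfl | hlt
    · rcases θ.2.1.eq_or_lt with h0 | h0
      · rw [← h0]; exact hwa
      -- `D` may already be positive at the least monopoly type, so `w` is controlled there by
      -- continuity from the left.
      · have hlim : Filter.Tendsto (fun z : ℝ => (v₁ - v₀) * ((θ : ℝ) - z))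
            (nhdsWithin (θ : ℝ) (Set.Iio θ)) (nhds ((v₁ - v₀) * ((θ : ℝ) - θ))) := by
          refine Filter.Tendsto.mono_left ?_ nhdsWithin_le_nhds
          exact (continuous_const.mul (continuous_const.sub continuous_id)).tendsto _
        rw [sub_self, mul_zero] at hlim
        refine ge_of_tendsto hlim ?_
        filter_upwards [Ioo_mem_nhdsLT h0] with z hz
        have h1 := h.w_lipschitz z θ hz.1.le hz.2.le θ.2.2
        have h2 := hlow ⟨z, hz.1.le, hz.2.le.trans θ.2.2⟩ hz.2
        simp only at h2
        linarith
    · exact hlow θ hlt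
  · have := h.value_le θ
    rw [hD θ hθ, mul_zero] at this
    linarith

end IsEnvelope

end SellingData

/-! ### Incentive constraints and the sale of full information -/

namespace SellingData

namespace Mechanism

variable {Ω : Type u} [MeasurableSpace Ω] [StandardBorelSpace Ω] [Nonempty Ω] {E : Market Ω}
  {v : Belief Ω → ℝ} {A : Set (Experiment Ω)}

/-- The utility of a type that reports truthfully. -/
noncomputable def utility (M : Mechanism E) (A : Set (Experiment Ω)) (θ : Set.Icc E.lo E.hi) : ℝ :=
  M.grossUtility A θ θ - M.pay θ

theorem utility_lipschitz (h : E.IsValueFunction v) (hA : E.IsAvailable A) (hlo : 0 ≤ E.lo)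
    {M : Mechanism E} (hM : M.IsIC A) {θ θ' : Set.Icc E.lo E.hi} (hθ : θ ≤ θ') :
    M.utility A θ' ≤ M.utility A θ +
      expectedValue v (Experiment.full Ω) E.prior * ((θ' : ℝ) - θ) := by
  have h1 := hM θ θ'
  have h2 : M.grossUtility A θ' θ' ≤ M.grossUtility A θ' θ + _ :=
    Market.IsAvailable.grossValue_lipschitz h hA hlo (M.alloc θ').observed hθ
  unfold utility
  linarith

theorem value_le_full (h : E.IsValueFunction v) (hA : E.IsAvailable A) (hlo : 0 ≤ E.lo)
    (M : Mechanism E) (r θ : Set.Icc E.lo E.hi) :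
    M.grossUtility A r θ ≤ expectedValue v (Experiment.full Ω) E.prior * (θ : ℝ) :=
  Market.IsAvailable.grossValue_le h hA hlo (M.alloc r).observed θ

theorem prior_le_value (h : E.IsValueFunction v) (hA : E.IsAvailable A) (hlo : 0 ≤ E.lo)
    (hnull : ∀ μ, E.cost (Experiment.null Ω) μ = 0)
    (M : Mechanism E) (r θ : Set.Icc E.lo E.hi) :
    v E.prior * (θ : ℝ) ≤ M.grossUtility A r θ :=
  (mul_le_mul_of_nonneg_right (h.monotone_prior.le_expectedValue _) (hlo.trans θ.2.1)).trans
    (Market.IsAvailable.expectedValue_le_grossValue h hA hlo (M.alloc r).observed hnull θ)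

theorem prior_le_utility (h : E.IsValueFunction v) (hA : E.IsAvailable A) (hlo : 0 ≤ E.lo)
    (hnull : ∀ μ, E.cost (Experiment.null Ω) μ = 0)
    {M : Mechanism E} (hM : M.IsIR A) (θ : Set.Icc E.lo E.hi) :
    v E.prior * (θ : ℝ) ≤ M.utility A θ :=
  (Market.IsAvailable.value_le_indirectValue h hA hlo h.monotone_prior hnull θ).trans (hM θ)

/-- Incremental value of higher types: a lower bound from the deviation to a lower report. -/
theorem utility_scale (h : E.IsValueFunction v) (hA : E.IsAvailable A) (hlo : 0 ≤ E.lo)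
    {M : Mechanism E} (hM : M.IsIC A) {θ θ' : Set.Icc E.lo E.hi} (hθ : θ ≤ θ') :
    M.grossUtility A θ θ * ((θ' : ℝ) - θ) ≤ (θ : ℝ) * (M.utility A θ' - M.utility A θ) := by
  have h1 := mul_le_mul_of_nonneg_left (hM θ' θ) (hlo.trans θ.2.1)
  have h2 : (θ' : ℝ) * M.grossUtility A θ θ ≤ (θ : ℝ) * M.grossUtility A θ θ' :=
    Market.IsAvailable.grossValue_scale h hA hlo (M.alloc θ).observed hθ
  unfold utility
  linarith

theorem utility_growth (h : E.IsValueFunction v) (hA : E.IsAvailable A) (hlo : 0 ≤ E.lo)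
    (hnull : ∀ μ, E.cost (Experiment.null Ω) μ = 0)
    {M : Mechanism E} (hM : M.IsIC A) {θ θ' : Set.Icc E.lo E.hi} (hθ : θ ≤ θ') :
    M.utility A θ + v E.prior * ((θ' : ℝ) - θ) ≤ M.utility A θ' := by
  -- `utility_scale` is vacuous at the type 0. There the gross value is at most 0, and the deviation
  -- to its report suffices.
  rcases (hlo.trans θ.2.1).eq_or_lt with h0 | h0
  · have h1 := hM θ' θ
    have h2 := prior_le_value h hA hlo hnull M θ θ'
    have h3 := value_le_full h hA hlo M θ θ
    rw [← h0, mul_zero] at h3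
    unfold utility
    rw [← h0]
    linarith
  · have h1 := utility_scale h hA hlo hM hθ
    have h2 := mul_le_mul_of_nonneg_right (prior_le_value h hA hlo hnull M θ θ)
      (sub_nonneg.2 (Subtype.coe_le_coe.2 hθ))
    refine le_of_mul_le_mul_left ?_ h0
    linarith

theorem utility_convex (h : E.IsValueFunction v) (hA : E.IsAvailable A) (hlo : 0 ≤ E.lo)
    {M : Mechanism E} (hM : M.IsIC A) {θ₁ θ₂ θ : Set.Icc E.lo E.hi} {a b : ℝ} (ha : 0 ≤ a)
    (hb : 0 ≤ b) (hab : a + b = 1) (hθ : (θ : ℝ) = a * θ₁ + b * θ₂) :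
    M.utility A θ ≤ a * M.utility A θ₁ + b * M.utility A θ₂ := by
  have h1 := mul_le_mul_of_nonneg_left (hM θ₁ θ) ha
  have h2 := mul_le_mul_of_nonneg_left (hM θ₂ θ) hb
  have h3 : M.grossUtility A θ θ ≤ a * M.grossUtility A θ θ₁ + b * M.grossUtility A θ θ₂ :=
    Market.IsAvailable.grossValue_convex h hA hlo (M.alloc θ).observed ha hb hab hθ
  have h4 : M.pay θ = a * M.pay θ + b * M.pay θ := by rw [← add_mul, hab, one_mul]
  unfold utility
  linarith

/-- The bound of the value by θD(θ) holds because the excess value per unit of type is a slope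
supporting `w` from the right, and `D` is the largest such slope. The highest type and the type 0
are covered by the full-information bound. -/
theorem exists_isEnvelope (h : E.IsValueFunction v) (hA : E.IsAvailable A) (hlo : 0 ≤ E.lo)
    (hle : E.lo ≤ E.hi) (hnull : ∀ μ, E.cost (Experiment.null Ω) μ = 0)
    {M : Mechanism E} (hM : M.IsIC A) :
    ∃ w D, IsEnvelope (fun θ => M.grossUtility A θ θ) M.pay (v E.prior)
      (expectedValue v (Experiment.full Ω) E.prior) w D := by
  set v₁ := expectedValue v (Experiment.full Ω) E.prior with hv₁
  set w : ℝ → ℝ := fun z => M.utility A (Set.projIcc E.lo E.hi hle z) - v E.prior * z with hw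
  have hwz : ∀ z (hz : z ∈ Set.Icc E.lo E.hi), w z = M.utility A ⟨z, hz⟩ - v E.prior * z := by
    intro z hz
    simp only [hw, Set.projIcc_of_mem hle hz]
  have hmono : ∀ z y, E.lo ≤ z → z ≤ y → y ≤ E.hi → w z ≤ w y := by
    intro z y hz hzy hy
    rw [hwz z ⟨hz, hzy.trans hy⟩, hwz y ⟨hz.trans hzy, hy⟩]
    have := utility_growth h hA hlo hnull hM (θ := ⟨z, hz, hzy.trans hy⟩)
      (θ' := ⟨y, hz.trans hzy, hy⟩) hzy
    simp only at this
    linarith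
  have hlip : ∀ z y, E.lo ≤ z → z ≤ y → y ≤ E.hi → w y ≤ w z + (v₁ - v E.prior) * (y - z) := by
    intro z y hz hzy hy
    rw [hwz z ⟨hz, hzy.trans hy⟩, hwz y ⟨hz.trans hzy, hy⟩]
    have := utility_lipschitz h hA hlo hM (θ := ⟨z, hz, hzy.trans hy⟩)
      (θ' := ⟨y, hz.trans hzy, hy⟩) hzy
    simp only at this
    linarith
  have hconv : ConvexOn ℝ (Set.Icc E.lo E.hi) w := by
    refine ⟨convex_Icc _ _, fun x hx y hy a b ha hb hab => ?_⟩
    have hz := convex_Icc E.lo E.hi hx hy ha hb hab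
    rw [hwz x hx, hwz y hy, hwz _ hz]
    have := utility_convex h hA hlo hM (θ₁ := ⟨x, hx⟩) (θ₂ := ⟨y, hy⟩) (θ := ⟨_, hz⟩) ha hb hab
      (by simp)
    simp only [smul_eq_mul] at this ⊢
    linarith
  have hgap : 0 ≤ v₁ - v E.prior := sub_nonneg.2 (h.monotone_prior.le_expectedValue _)
  obtain ⟨D, hD, hD0, hDle, htop, hr, hl, hs⟩ := exists_rightSlope hconv hle hgap hmono hlip
  refine ⟨w, D, fun θ => hwz θ θ.2, hD, hD0, hDle, hr, hl, fun θ => ?_, hmono, hlip⟩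
  rcases θ.2.2.eq_or_lt with hhi | hhi
  · have := value_le_full h hA hlo M θ θ
    rw [hhi] at this
    rw [hhi, htop]
    linarith
  · rcases (hlo.trans θ.2.1).eq_or_lt with h0 | h0
    · have := value_le_full h hA hlo M θ θ
      rw [← h0] at this ⊢
      linarith
    · rw [mul_comm (θ : ℝ) (D θ), ← div_le_iff₀ h0]
      refine hs θ _ θ.2.1 hhi fun y hθy hy => ?_
      have h1 := utility_scale h hA hlo hM (θ := θ) (θ' := ⟨y, θ.2.1.trans hθy.le, hy⟩) hθy.le
      rw [hwz θ θ.2, hwz y ⟨θ.2.1.trans hθy.le, hy⟩, div_mul_eq_mul_div, div_le_iff₀ h0]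
      simp only [Subtype.coe_eta] at h1 ⊢
      linarith

/-- The mechanism `M` with the full information sold to all types above `a`, at the price that
makes the type `a` indifferent. -/
noncomputable def sellFullAbove (M : Mechanism E) (A : Set (Experiment Ω)) (a : Set.Icc E.lo E.hi)
    (v₁ : ℝ) : Mechanism E where
  alloc θ := open Classical in
    if a ≤ θ then RandomExperiment.sure (Experiment.full Ω) else M.alloc θ
  pay θ := open Classical in if a ≤ θ then v₁ * a - M.utility A a else M.pay θ

theorem grossValue_sure_full (h : E.IsValueFunction v) (hA : E.IsAvailable A) (hlo : 0 ≤ E.lo)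
    (hnull : ∀ μ, E.cost (Experiment.null Ω) μ = 0) (θ : Set.Icc E.lo E.hi) :
    E.grossValue A (RandomExperiment.sure (Experiment.full Ω)).observed θ =
      expectedValue v (Experiment.full Ω) E.prior * (θ : ℝ) := by
  refine le_antisymm (Market.IsAvailable.grossValue_le h hA hlo _ θ) ?_
  refine le_trans (mul_le_mul_of_nonneg_right ?_ (hlo.trans θ.2.1))
    (Market.IsAvailable.expectedValue_le_grossValue h hA hlo _ hnull θ)
  exact h.monotone_prior.2 _ _ (RandomExperiment.isGarblingOf_observed_sure _)

section SellFullAbove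

variable {M : Mechanism E} {a : Set.Icc E.lo E.hi}

theorem grossUtility_sellFullAbove_of_le (h : E.IsValueFunction v) (hA : E.IsAvailable A)
    (hlo : 0 ≤ E.lo) (hnull : ∀ μ, E.cost (Experiment.null Ω) μ = 0) {v₁ : ℝ}
    {r : Set.Icc E.lo E.hi} (hr : a ≤ r) (θ : Set.Icc E.lo E.hi) :
    (M.sellFullAbove A a v₁).grossUtility A r θ =
      expectedValue v (Experiment.full Ω) E.prior * (θ : ℝ) := by
  rw [← grossValue_sure_full h hA hlo hnull θ]
  simp only [grossUtility, sellFullAbove, if_pos hr, Market.grossValue]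

theorem grossUtility_sellFullAbove_of_not_le {v₁ : ℝ} {r : Set.Icc E.lo E.hi} (hr : ¬ a ≤ r)
    (θ : Set.Icc E.lo E.hi) :
    (M.sellFullAbove A a v₁).grossUtility A r θ = M.grossUtility A r θ := by
  simp only [grossUtility, sellFullAbove, if_neg hr]

theorem pay_sellFullAbove_of_le {v₁ : ℝ} {r : Set.Icc E.lo E.hi} (hr : a ≤ r) :
    (M.sellFullAbove A a v₁).pay r = v₁ * a - M.utility A a := by
  simp only [sellFullAbove, if_pos hr]

theorem pay_sellFullAbove_of_not_le {v₁ : ℝ} {r : Set.Icc E.lo E.hi} (hr : ¬ a ≤ r) :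
    (M.sellFullAbove A a v₁).pay r = M.pay r := by
  simp only [sellFullAbove, if_neg hr]

/-- The new option gives a utility line of the maximal slope through the old utility at `a`. It lies
above the old utility to the right of `a` and below it to the left, so higher types gain and lower
types do not switch. -/
theorem IsFeasible.sellFullAbove (h : E.IsValueFunction v) (hA : E.IsAvailable A) (hlo : 0 ≤ E.lo)
    (hnull : ∀ μ, E.cost (Experiment.null Ω) μ = 0) [IsProbabilityMeasure E.typeLaw]
    (hM : M.IsFeasible A) (a : Set.Icc E.lo E.hi) :
    (M.sellFullAbove A a (expectedValue v (Experiment.full Ω) E.prior)).IsFeasible A := by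
  set v₁ := expectedValue v (Experiment.full Ω) E.prior with hv₁
  obtain ⟨hIC, hIR, hpay⟩ := hM
  have hu : ∀ θ, M.utility A θ ≤ (M.sellFullAbove A a v₁).grossUtility A θ θ -
      (M.sellFullAbove A a v₁).pay θ := by
    intro θ
    by_cases hθ : a ≤ θ
    · rw [grossUtility_sellFullAbove_of_le h hA hlo hnull hθ, pay_sellFullAbove_of_le hθ]
      have := utility_lipschitz h hA hlo hIC hθ
      linarith
    · rw [grossUtility_sellFullAbove_of_not_le hθ, pay_sellFullAbove_of_not_le hθ]
      rfl
  refine ⟨fun θ r => ?_, fun θ => (hIR θ).trans (hu θ), ?_⟩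
  · by_cases hr : a ≤ r
    · rw [grossUtility_sellFullAbove_of_le h hA hlo hnull hr, pay_sellFullAbove_of_le hr]
      by_cases hθ : a ≤ θ
      · rw [grossUtility_sellFullAbove_of_le h hA hlo hnull hθ, pay_sellFullAbove_of_le hθ]
      · refine le_trans ?_ (hu θ)
        have := utility_lipschitz h hA hlo hIC (not_le.1 hθ).le
        linarith
    · rw [grossUtility_sellFullAbove_of_not_le hr, pay_sellFullAbove_of_not_le hr]
      exact (hIC θ r).trans (hu θ)
  · classical
    have : (M.sellFullAbove A a v₁).pay =
        (Set.Ici a).piecewise (fun _ => v₁ * a - M.utility A a) M.pay := by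
      ext θ
      by_cases hθ : a ≤ θ
      · rw [pay_sellFullAbove_of_le hθ, Set.piecewise_eq_of_mem _ _ _ (Set.mem_Ici.2 hθ)]
      · rw [pay_sellFullAbove_of_not_le hθ, Set.piecewise_eq_of_notMem _ _ _ (mt Set.mem_Ici.1 hθ)]
    rw [this]
    exact Integrable.piecewise measurableSet_Ici (integrable_const _) hpay.integrableOn

theorem revenue_sellFullAbove [IsProbabilityMeasure E.typeLaw] {v₁ : ℝ}
    (hp : Integrable M.pay E.typeLaw)
    (hp' : Integrable (M.sellFullAbove A a v₁).pay E.typeLaw) :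
    (M.sellFullAbove A a v₁).revenue = M.revenue - ∫ θ in Set.Ici a, M.pay θ ∂E.typeLaw +
      (v₁ * a - M.utility A a) * E.typeLaw.real (Set.Ici a) := by
  unfold revenue
  rw [← integral_add_compl (measurableSet_Ici (a := a)) hp,
    ← integral_add_compl (measurableSet_Ici (a := a)) hp',
    setIntegral_congr_fun (g := fun _ => v₁ * a - M.utility A a) measurableSet_Ici
      (fun θ hθ => pay_sellFullAbove_of_le hθ),
    setIntegral_congr_fun (g := M.pay) measurableSet_Ici.compl
      (fun θ hθ => pay_sellFullAbove_of_not_le hθ)]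
  simp
  ring

end SellFullAbove

/-- The mechanism that sells nothing. -/
noncomputable def sellNothing (E : Market Ω) : Mechanism E where
  alloc _ := RandomExperiment.sure (Experiment.null Ω)
  pay _ := 0

theorem grossUtility_sellNothing (h : E.IsValueFunction v)
    (hnull : ∀ μ, E.cost (Experiment.null Ω) μ = 0) (r θ : Set.Icc E.lo E.hi) :
    (sellNothing E).grossUtility {Experiment.null Ω} r θ = v E.prior * (θ : ℝ) := by
  refine (h.grossValue_null hnull _ θ).trans ?_
  congr 1
  refine le_antisymm ?_ (h.monotone_prior.le_expectedValue _)
  rw [← h.monotone_prior.expectedValue_null]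
  exact h.monotone_prior.2 _ _ (RandomExperiment.observed_sure_isGarblingOf _)

theorem utility_sellNothing (h : E.IsValueFunction v)
    (hnull : ∀ μ, E.cost (Experiment.null Ω) μ = 0) (θ : Set.Icc E.lo E.hi) :
    (sellNothing E).utility {Experiment.null Ω} θ = v E.prior * (θ : ℝ) := by
  unfold utility
  rw [grossUtility_sellNothing h hnull]
  simp [sellNothing]

theorem isFeasible_sellNothing (h : E.IsValueFunction v)
    (hnull : ∀ μ, E.cost (Experiment.null Ω) μ = 0) :
    (sellNothing E).IsFeasible {Experiment.null Ω} := by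
  refine ⟨fun θ r => ?_, fun θ => ?_, integrable_zero _ _ _⟩
  · rw [grossUtility_sellNothing h hnull, grossUtility_sellNothing h hnull]
    exact le_rfl
  · rw [h.indirectValue_null hnull h.monotone_prior]
    exact (utility_sellNothing h hnull θ).ge

end Mechanism

/-! ### Optimal mechanisms with and without acquisition -/

section Comparison

open Mechanism

variable {Ω : Type u} [MeasurableSpace Ω] [StandardBorelSpace Ω] [Nonempty Ω] {E : Market Ω}
  [IsProbabilityMeasure E.typeLaw] {v : Belief Ω → ℝ} {A : Set (Experiment Ω)}

namespace Mechanism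

/-- The envelopes supply the integrability that turns pointwise comparisons into comparisons of
expectations. -/
theorem outcomeLE_of_le (h : E.IsValueFunction v) (hlo : 0 ≤ E.lo)
    (hnull : ∀ μ, E.cost (Experiment.null Ω) μ = 0) {A₀ A : Set (Experiment Ω)}
    (hA₀ : E.IsAvailable A₀) (hA : E.IsAvailable A) {M₀ M : Mechanism E} (hM₀ : M₀.IsFeasible A₀)
    (hM : M.IsFeasible A) (hu : ∀ θ, M₀.utility A₀ θ ≤ M.utility A θ)
    (hx : ∀ᵐ θ ∂E.typeLaw, M₀.grossUtility A₀ θ θ ≤ M.grossUtility A θ θ) :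
    M₀.OutcomeLE A₀ M A := by
  obtain ⟨w₀, D₀, h₀⟩ := exists_isEnvelope h hA₀ hlo E.lo_le_hi hnull hM₀.1
  obtain ⟨w, D, h₁⟩ := exists_isEnvelope h hA hlo E.lo_le_hi hnull hM.1
  exact ⟨integral_mono_ae (h₀.integrable_value hM₀.2.2) (h₁.integrable_value hM.2.2) hx,
    integral_mono h₀.integrable_utility h₁.integrable_utility hu, hx⟩

/-- Selling full information above a monopoly type does not lower the revenue. -/
theorem revenue_le_sellFullAbove (h : E.IsValueFunction v) (hA : E.IsAvailable A)
    (hlo : 0 ≤ E.lo) (hnull : ∀ μ, E.cost (Experiment.null Ω) μ = 0) {M : Mechanism E}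
    (hM : M.IsFeasible A) {m : Set.Icc E.lo E.hi} (hm : E.IsMonopolyType m) :
    M.revenue ≤
      (M.sellFullAbove A m (expectedValue v (Experiment.full Ω) E.prior)).revenue := by
  obtain ⟨w, D, henv⟩ := exists_isEnvelope h hA hlo E.lo_le_hi hnull hM.1
  rw [revenue_sellFullAbove hM.2.2 (hM.sellFullAbove h hA hlo hnull m).2.2]
  have h1 := henv.setIntegral_pay_le hlo hM.2.2 m hm
  have h2 : w m = M.utility A m - _ := henv.w_eq m
  unfold Market.priceRevenue at h1
  rw [h2] at h1
  linarith

/-- If selling full information above a monopoly type does not raise the revenue, then the payments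
above this type attain their bound. -/
theorem attains_of_isOptimal (h : E.IsValueFunction v) (hA : E.IsAvailable A)
    (hlo : 0 ≤ E.lo) (hnull : ∀ μ, E.cost (Experiment.null Ω) μ = 0) {M : Mechanism E}
    (hM : M.IsOptimal A) (m : Set.Icc E.lo E.hi) {w D : ℝ → ℝ}
    (henv : IsEnvelope (fun θ => M.grossUtility A θ θ) M.pay (v E.prior)
      (expectedValue v (Experiment.full Ω) E.prior) w D) :
    (expectedValue v (Experiment.full Ω) E.prior - v E.prior) * E.priceRevenue m ≤
      ∫ θ in Set.Ici m, M.pay θ ∂E.typeLaw + w m * E.typeLaw.real (Set.Ici m) := by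
  have hf := hM.1.sellFullAbove h hA hlo hnull m
  have h1 := hM.2 _ hf
  rw [revenue_sellFullAbove hM.1.2.2 hf.2.2] at h1
  have h2 : w m = M.utility A m - _ := henv.w_eq m
  unfold Market.priceRevenue
  rw [h2]
  linarith

/-- The revenue of a posted price for full information, without information acquisition. -/
theorem revenue_postedPrice (h : E.IsValueFunction v) (hlo : 0 ≤ E.lo)
    (hnull : ∀ μ, E.cost (Experiment.null Ω) μ = 0) (m : Set.Icc E.lo E.hi) :
    ((sellNothing E).sellFullAbove {Experiment.null Ω} m
        (expectedValue v (Experiment.full Ω) E.prior)).revenue =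
      (expectedValue v (Experiment.full Ω) E.prior - v E.prior) * E.priceRevenue m := by
  have hN := isFeasible_sellNothing h hnull
  rw [revenue_sellFullAbove hN.2.2
    (hN.sellFullAbove h (h.isAvailable_null hnull) hlo hnull m).2.2, utility_sellNothing h hnull]
  unfold Market.priceRevenue revenue
  simp [sellNothing]
  ring

/-- A posted price for full information at a monopoly type is optimal without information
acquisition. -/
theorem isOptimal_postedPrice (h : E.IsValueFunction v) (hlo : 0 ≤ E.lo)
    (hnull : ∀ μ, E.cost (Experiment.null Ω) μ = 0) {m : Set.Icc E.lo E.hi}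
    (hm : E.IsMonopolyType m) :
    ((sellNothing E).sellFullAbove {Experiment.null Ω} m
        (expectedValue v (Experiment.full Ω) E.prior)).IsOptimal {Experiment.null Ω} := by
  have hA := h.isAvailable_null hnull
  refine ⟨(isFeasible_sellNothing h hnull).sellFullAbove h hA hlo hnull m, fun M hM => ?_⟩
  rw [revenue_postedPrice h hlo hnull]
  obtain ⟨w, D, henv⟩ := exists_isEnvelope h hA hlo E.lo_le_hi hnull hM.1
  have hle := E.lo_le_hi
  have h1 := henv.setIntegral_pay_le hlo hM.2.2 ⟨E.lo, le_rfl, hle⟩ hm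
  have hIci : Set.Ici (⟨E.lo, le_rfl, hle⟩ : Set.Icc E.lo E.hi) = Set.univ := by
    ext y; exact ⟨fun _ => trivial, fun _ => y.2.1⟩
  rw [hIci, Measure.restrict_univ, probReal_univ] at h1
  have h2 : w E.lo = M.utility {Experiment.null Ω} ⟨E.lo, le_rfl, hle⟩ - _ :=
    henv.w_eq ⟨E.lo, le_rfl, hle⟩
  have h3 := prior_le_utility h hA hlo hnull hM.2.1 ⟨E.lo, le_rfl, hle⟩
  unfold revenue
  linarith

/-- Optimal mechanisms fully inform the types above the greatest monopoly type. -/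
theorem IsOptimal.above_greatest (h : E.IsValueFunction v) (hA : E.IsAvailable A)
    (hlo : 0 ≤ E.lo) (hnull : ∀ μ, E.cost (Experiment.null Ω) μ = 0) {M : Mechanism E}
    (hM : M.IsOptimal A) {a : Set.Icc E.lo E.hi} (ha : IsGreatest {θ | E.IsMonopolyType θ} a) :
    (∀ θ, a ≤ θ → v E.prior * a + expectedValue v (Experiment.full Ω) E.prior * ((θ : ℝ) - a) ≤
        M.utility A θ) ∧
      ∀ᵐ θ ∂E.typeLaw, a ≤ θ → M.grossUtility A θ θ =
        expectedValue v (Experiment.full Ω) E.prior * (θ : ℝ) := by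
  obtain ⟨w, D, henv⟩ := exists_isEnvelope h hA hlo E.lo_le_hi hnull hM.1.1
  obtain ⟨h1, h2⟩ := henv.top_of_attains hlo hM.1.2.2 ha
    (attains_of_isOptimal h hA hlo hnull hM a henv)
  refine ⟨fun θ hθ => ?_, h2⟩
  have h3 := h1 θ hθ
  have h4 : w θ = M.utility A θ - _ := henv.w_eq θ
  have h5 : w a = M.utility A a - _ := henv.w_eq a
  have h6 := prior_le_utility h hA hlo hnull hM.1.2.1 a
  linarith

/-- Without information acquisition, optimal mechanisms do not inform the types below the least
monopoly type. -/
theorem IsOptimal.below_least (h : E.IsValueFunction v) (hlo : 0 ≤ E.lo)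
    (hnull : ∀ μ, E.cost (Experiment.null Ω) μ = 0) {M : Mechanism E}
    (hM : M.IsOptimal {Experiment.null Ω}) {m : Set.Icc E.lo E.hi}
    (hm : IsLeast {θ | E.IsMonopolyType θ} m) :
    (∀ θ, θ ≤ m → M.utility {Experiment.null Ω} θ ≤ v E.prior * (θ : ℝ)) ∧
      (∀ θ, m ≤ θ → M.utility {Experiment.null Ω} θ ≤
        v E.prior * m + expectedValue v (Experiment.full Ω) E.prior * ((θ : ℝ) - m)) ∧
      ∀ θ, θ < m → M.grossUtility {Experiment.null Ω} θ θ ≤ v E.prior * (θ : ℝ) := by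
  have hA := h.isAvailable_null hnull
  obtain ⟨w, D, henv⟩ := exists_isEnvelope h hA hlo E.lo_le_hi hnull hM.1.1
  have hrev := hM.2 _ (isOptimal_postedPrice h hlo hnull hm.1).1
  rw [revenue_postedPrice h hlo hnull] at hrev
  have hw : ∀ θ : Set.Icc E.lo E.hi, w θ = M.utility {Experiment.null Ω} θ - v E.prior * θ :=
    henv.w_eq
  obtain ⟨h1, h2⟩ := henv.bot_of_attains hlo hM.1.2.2 (fun θ => by
    have := prior_le_utility h hA hlo hnull hM.1.2.1 θ
    rw [hw]; linarith) hm hrev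
  have h3 : ∀ θ, θ ≤ m → M.utility {Experiment.null Ω} θ ≤ v E.prior * (θ : ℝ) := fun θ hθ => by
    have := h1 θ hθ
    rw [hw] at this
    linarith
  refine ⟨h3, fun θ hθ => ?_, h2⟩
  have := utility_lipschitz h hA hlo hM.1.1 hθ
  linarith [h3 m le_rfl]

end Mechanism

end Comparison

end SellingData

/-! ### The comparison theorem -/

theorem proposition4 {Ω : Type u} [MeasurableSpace Ω] [StandardBorelSpace Ω] [Nonempty Ω]
    (E : SellingData.Market Ω) [IsProbabilityMeasure E.typeLaw]
    (hlo : 0 ≤ E.lo) (hsep : E.IsSeparable) (hV : E.IsBlackwellMonotone)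
    (hnull : ∀ μ, E.cost (SellingData.Experiment.null Ω) μ = 0) :
    -- some optimal mechanism without information acquisition is below every optimal mechanism
    -- with information acquisition
    (∃ M₀ : SellingData.Mechanism E, M₀.IsOptimal {SellingData.Experiment.null Ω} ∧
      ∀ A, E.IsAvailable A → ∀ M : SellingData.Mechanism E, M.IsOptimal A →
        M₀.OutcomeLE {SellingData.Experiment.null Ω} M A) ∧
    -- if there are optimal mechanisms with information acquisition, then one of them is above
    -- every optimal mechanism without information acquisition
    (∀ A, E.IsAvailable A → (∃ M : SellingData.Mechanism E, M.IsOptimal A) →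
      ∃ M : SellingData.Mechanism E, M.IsOptimal A ∧
        ∀ M₀ : SellingData.Mechanism E, M₀.IsOptimal {SellingData.Experiment.null Ω} →
          M₀.OutcomeLE {SellingData.Experiment.null Ω} M A) ∧
    -- if the monopoly type is unique, then all optimal mechanisms compare in this way
    ((∃! θ, E.IsMonopolyType θ) → ∀ A, E.IsAvailable A →
      ∀ M₀ M : SellingData.Mechanism E, M₀.IsOptimal {SellingData.Experiment.null Ω} →
        M.IsOptimal A → M₀.OutcomeLE {SellingData.Experiment.null Ω} M A) := by
  open SellingData SellingData.Mechanism in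
  obtain ⟨v, h⟩ := E.exists_isValueFunction hlo hsep hV
  have hN := h.isAvailable_null hnull
  have hne := E.nonempty_monopolyTypes hlo
  have hcpt := E.isCompact_monopolyTypes hlo
  obtain ⟨a, ha⟩ := hcpt.exists_isGreatest hne
  obtain ⟨m, hm⟩ := hcpt.exists_isLeast hne
  -- The greatest monopoly price informs as few types as an optimal posted price can.
  refine ⟨⟨_, isOptimal_postedPrice h hlo hnull ha.1, fun A hA M hM => ?_⟩,
    fun A hA ⟨M, hM⟩ => ?_, fun huniq A hA M₀ M hM₀ hM => ?_⟩
  · obtain ⟨hu, hx⟩ := hM.above_greatest h hA hlo hnull ha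
    refine outcomeLE_of_le h hlo hnull hN hA
      (isOptimal_postedPrice h hlo hnull ha.1).1 hM.1 (fun θ => ?_) ?_
    · by_cases hθ : a ≤ θ
      · refine le_trans ?_ (hu θ hθ)
        unfold utility
        rw [grossUtility_sellFullAbove_of_le h hN hlo hnull hθ, pay_sellFullAbove_of_le hθ,
          utility_sellNothing h hnull]
        linarith
      · refine le_trans ?_ (prior_le_utility h hA hlo hnull hM.1.2.1 θ)
        unfold utility
        rw [grossUtility_sellFullAbove_of_not_le hθ, pay_sellFullAbove_of_not_le hθ]
        exact (utility_sellNothing h hnull θ).le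
    · filter_upwards [hx] with θ hxθ
      by_cases hθ : a ≤ θ
      · rw [grossUtility_sellFullAbove_of_le h hN hlo hnull hθ, hxθ hθ]
      · rw [grossUtility_sellFullAbove_of_not_le hθ, grossUtility_sellNothing h hnull]
        exact prior_le_value h hA hlo hnull M θ θ
  -- Any optimal mechanism stays optimal when full information is sold from the least monopoly type
  -- on; this makes it large enough to dominate.
  · have hf := hM.1.sellFullAbove h hA hlo hnull m
    refine ⟨_, ⟨hf, fun M' hM' =>
      (hM.2 M' hM').trans (revenue_le_sellFullAbove h hA hlo hnull hM.1 hm.1)⟩, fun M₀ hM₀ => ?_⟩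
    obtain ⟨hlow, hhigh, hx⟩ := hM₀.below_least h hlo hnull hm
    refine outcomeLE_of_le h hlo hnull hN hA hM₀.1 hf (fun θ => ?_)
      (Filter.Eventually.of_forall fun θ => ?_)
    · by_cases hθ : m ≤ θ
      · refine (hhigh θ hθ).trans ?_
        unfold utility
        rw [grossUtility_sellFullAbove_of_le h hA hlo hnull hθ, pay_sellFullAbove_of_le hθ]
        linarith [prior_le_utility h hA hlo hnull hM.1.2.1 m]
      · exact (hlow θ (not_le.1 hθ).le).trans (prior_le_utility h hA hlo hnull hf.2.1 θ)
    · by_cases hθ : m ≤ θ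
      · rw [grossUtility_sellFullAbove_of_le h hA hlo hnull hθ]
        exact value_le_full h hN hlo M₀ θ θ
      · exact (hx θ (not_le.1 hθ)).trans (prior_le_value h hA hlo hnull _ θ θ)
  -- With a single monopoly type, the descriptions below the least and above the greatest one cover
  -- all types.
  · obtain rfl : m = a := huniq.unique hm.1 ha.1
    obtain ⟨hu, hx⟩ := hM.above_greatest h hA hlo hnull ha
    obtain ⟨hlow, hhigh, hx₀⟩ := hM₀.below_least h hlo hnull hm
    refine outcomeLE_of_le h hlo hnull hN hA hM₀.1 hM.1 (fun θ => ?_) ?_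
    · by_cases hθ : m ≤ θ
      · exact (hhigh θ hθ).trans (hu θ hθ)
      · exact (hlow θ (not_le.1 hθ).le).trans (prior_le_utility h hA hlo hnull hM.1.2.1 θ)
    · filter_upwards [hx] with θ hxθ
      by_cases hθ : m ≤ θ
      · rw [hxθ hθ]
        exact value_le_full h hN hlo M₀ θ θ
      · exact (hx₀ θ (not_le.1 hθ)).trans (prior_le_value h hA hlo hnull M θ θ)
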